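/- Let $m\ge 1$ and $d\ge 3$ be integers, and consider a deck of $n=D_1+\cdots+D_m$ cards with $D_i\ge d$ cards of type $i$ for $1\le i\le m$ (cards of the same type being indistinguishable), initially sorted: the $1$'s on top, followed by the $2$'s, and so on down to the $m$'s at the bottom. An *$a$-shuffle* ($a\ge 1$ an integer) cuts the deck into $a$ packets whose sizes $A_1,\dots,A_a\ge 0$, from top to bottom, have the multinomial distribution $\frac{1}{a^n}\binom{n}{A_1,\dots,A_a}$, and then drops the cards one at a time, each from the bottom of a packet chosen with probability proportional to its current size, each dropped card landing on top of those dropped before. The ordinary (Gilbert–Shannon–Reeds) riffle shuffle is the case $a=2$; $k$ successive riffle shuffles have as law on $S_n$ the $k$-th convolution power of the law of one. The *separation distance* of a law $Q$ of the shuffled deck is $\max_w\bigl(1-Q(w)/U(w)\bigr)$, where $w$ ranges over the $\binom{n}{D_1,\dots,D_m}$ possible configurations of the deck and $U(w)=1/\binom{n}{D_1,\dots,D_m}$. Then, for every integer $a\ge 1$, the separation distance after one $a$-shuffle is $$1-(1+\eta)\,\frac{a^{m-1}}{(n+1)\cdots(n+m-1)}\sum_{j=0}^{m-1}(-1)^j\binom{m-1}{j}\Bigl(1-\frac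 ja\Bigr)^{n+m-1}$$ for a real number $\eta$ satisfying $$|\eta|\le\Bigl(1+\frac{n^2}{3(d-2)(a-m+1)^2}\Bigr)^{m-1}-1,$$ where in the degenerate case $a=m-1$ the right-hand side is read as $+\infty$. Likewise, for every integer $k\ge 0$, the separation distance after $k$ riffle shuffles is given by the same formula, with $a=2^k$ and with $\eta$ satisfying the same bound. -/

import Mathlib

noncomputable section

namespace RiffleShuffle

/-- A configuration of a deck of `n` cards of `m` types: `w p` is the type of the card in
position `p`, where position `0` is the top of the deck.  The deck is sorted with `D i` cards of
type `i` if the types increase weakly from top to bottom and type `i` occurs `D i` times. -/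
def IsSortedDeck {n m : ℕ} (D : Fin m → ℕ) (w : Fin n → Fin m) : Prop :=
  Monotone w ∧ ∀ i, (Finset.univ.filter fun p => w p = i).card = D i

/-- The probability that a deck of `n` cards is cut into `a` packets of sizes `A 0, …, A (a-1)`
(from the top of the deck to the bottom): the multinomial distribution. -/
def cutProb {a : ℕ} (n : ℕ) (A : Fin a → ℕ) : ℝ :=
  (Nat.multinomial Finset.univ A : ℝ) / (a : ℝ) ^ n

/-- The number of cards among those dropped before time `t` that came from packet `i`, when the
card dropped at time `s` comes from packet `g s`. -/
def droppedBefore {n a : ℕ} (g : Fin n → Fin a) (t : Fin n) (i : Fin a) : ℕ :=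
  (Finset.univ.filter fun s => s < t ∧ g s = i).card

/-- The probability that, starting from packets of sizes `A`, the cards are dropped from the
packets `g 0, g 1, …, g (n-1)` in this order, if at each time the packet from which the next card
is dropped is chosen with probability proportional to its current size: at time `t` packet `i` has
`A i - droppedBefore g t i` cards left, out of `n - t` cards. -/
def dropProb {n a : ℕ} (A : Fin a → ℕ) (g : Fin n → Fin a) : ℝ :=
  ∏ t : Fin n, ((A (g t) - droppedBefore g t (g t) : ℕ) : ℝ) / ((n - (t : ℕ) : ℕ) : ℝ)

/-- Cutting the deck into packets of sizes `A` and dropping the cards in the order `g` moves the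
card in position `p` to position `σ p`, for all `p`.  Each dropped card is the bottom card of what
is left of its packet, and it lands on top of the cards dropped before: the card dropped at
time `t` ends in position `n - 1 - t`.  (Packet `i` ends just above position
`A 0 + ⋯ + A i` of the deck before the shuffle.) -/
def Produces {n a : ℕ} (A : Fin a → ℕ) (g : Fin n → Fin a) (σ : Equiv.Perm (Fin n)) : Prop :=
  ∀ t : Fin n,
    (σ.symm t.rev : ℕ) + 1 + droppedBefore g t (g t) = ∑ j ∈ Finset.Iic (g t), A j

open scoped Classical in
/-- The measure `Q_a` of an `a`-shuffle on the symmetric group: the deck is cut into `a` packets by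
the multinomial distribution, then cards are dropped from the packets with probability
proportional to packet size.  For `a = 2` this is the Gilbert-Shannon-Reeds riffle shuffle. -/
def shuffle (n a : ℕ) (σ : Equiv.Perm (Fin n)) : ℝ :=
  ∑ A ∈ Finset.piAntidiag (Finset.univ : Finset (Fin a)) n, ∑ g : Fin n → Fin a,
    if Produces A g σ then cutProb n A * dropProb A g else 0

/-- Convolution powers of a measure on the symmetric group. -/
def convPow {n : ℕ} (Q : Equiv.Perm (Fin n) → ℝ) : ℕ → Equiv.Perm (Fin n) → ℝ
  | 0 => fun σ => if σ = 1 then 1 else 0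
  | k + 1 => fun σ => ∑ τ : Equiv.Perm (Fin n), Q τ * convPow Q k (σ * τ⁻¹)

/-- The configuration obtained from `w` when the card in position `p` moves to position `σ p`. -/
def rearrange {n m : ℕ} (w : Fin n → Fin m) (σ : Equiv.Perm (Fin n)) : Fin n → Fin m :=
  fun p => w (σ.symm p)

/-- The configurations of the deck with the same cards as `w`. -/
def configurations {n m : ℕ} (w : Fin n → Fin m) : Finset (Fin n → Fin m) :=
  Finset.univ.image (rearrange w)

theorem configurations_nonempty {n m : ℕ} (w : Fin n → Fin m) : (configurations w).Nonempty :=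
  Finset.univ_nonempty.image _

/-- The probability of the configuration `v` after a deck starting in configuration `w` has been
permuted by a random permutation with law `Q`. -/
def configProb {n m : ℕ} (Q : Equiv.Perm (Fin n) → ℝ) (w v : Fin n → Fin m) : ℝ :=
  ∑ σ ∈ Finset.univ.filter (fun σ => rearrange w σ = v), Q σ

/-- The separation distance `max_v (1 - Q(v) / U(v))` from the uniform distribution
`U(v) = 1 / #configurations`, for a deck that starts in configuration `w`. -/
def separation {n m : ℕ} (Q : Equiv.Perm (Fin n) → ℝ) (w : Fin n → Fin m) : ℝ :=
  (configurations w).sup' (configurations_nonempty w) fun v =>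
    1 - configProb Q w v / (1 / ((configurations w).card : ℝ))

/-- `a^(m-1) / ((n+1)⋯(n+m-1)) * ∑_{j=0}^{m-1} (-1)^j C(m-1,j) (1 - j/a)^(n+m-1)`. -/
def thumbTerm (n m a : ℕ) : ℝ :=
  (a : ℝ) ^ (m - 1) / (∏ i ∈ Finset.Icc 1 (m - 1), ((n : ℝ) + (i : ℝ))) *
    ∑ j ∈ Finset.range m,
      (-1 : ℝ) ^ j * ((m - 1).choose j : ℝ) * (1 - (j : ℝ) / (a : ℝ)) ^ (n + m - 1)

/-- `(1 + n^2 / (3 (d-2) (a-m+1)^2))^(m-1) - 1`. -/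
def thumbError (n m d a : ℕ) : ℝ :=
  (1 + (n : ℝ) ^ 2 / (3 * ((d : ℝ) - 2) * ((a : ℝ) - (m : ℝ) + 1) ^ 2)) ^ (m - 1) - 1

end RiffleShuffle

end

/-!
An `a`-shuffle is the stable sort of a uniformly random word of length `n` in `a` letters
(`shuffle_eq`).  Sorting by one word and then by another is sorting by a word of pairs, so an
`a`-shuffle followed by a `b`-shuffle is an `ab`-shuffle (`shuffle_conv`), and `k` riffle shuffles
are a `2 ^ k`-shuffle.

A word takes the sorted deck to a configuration `v` exactly when cards of different types are
ranked by their types.  Composing with a permutation turns the words for the reversed deck into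
words for `v`, so the reversed deck is the least likely configuration (`separation_shuffle`).  Its
words are those in which the letters of each type are smaller than the letters of the next; choosing
the largest letter of each type but the last gives
`∑ x_m ^ D_m * ∏_{i < m} (x_i ^ D_i - (x_i - 1) ^ D_i)` over all positive integers `x_i` of sum `a`
(`card_strictWords`).

Each difference `x ^ D - (x - 1) ^ D` is the average over `ξ` in `[0, 1]` of `D (x - ξ) ^ (D - 1)`.
For fixed `ξ` the sum is an iterated lattice convolution of powers.  Replacing one lattice sum by an
integral makes, by the trapezoidal rule, an error of at most `1 / 8` times `∫ q`, where `-q` is a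
lower bound for the second derivative of the integrand `y ^ r (x - y) ^ s / (r! s!)`.  That second
derivative is a square minus terms of integral `(1 / (r - 1) + 1 / (s - 1))` times
`x ^ (r + s - 1) / (r + s - 1)!` (`abs_sum_truncPow_mul_sub_le`).  With the normalization
`x ^ N / N!` each step thus costs at most `(d/dx)² / (3 (d - 2))` applied to the integral, whatever
the exponents are, and `m - 1` steps cost the factor `(1 + (d/dx)² / (3 (d - 2))) ^ (m - 1)`
(`abs_strictCount_sub_le`).  After averaging over all `ξ` the main term is an iterated difference of
powers (`thumbTerm_eq`), and since the arguments in the average are at least `a - m + 1`, two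
derivatives cost at most the relative factor `n ^ 2 / (a - m + 1) ^ 2` (`errorBound_le`).

If there are fewer letters than types, then the reversed deck cannot occur and `η = -1`.
-/

namespace RiffleShuffle

open Finset

/-! ### The law of an `a`-shuffle -/

/-- The inverse of `Tuple.sort u` ranks the positions by the pair (letter, position). -/
theorem sort_symm_le_iff {n : ℕ} {α : Type*} [LinearOrder α] (u : Fin n → α) (p q : Fin n) :
    (Tuple.sort u).symm q ≤ (Tuple.sort u).symm p ↔ u q < u p ∨ (u q = u p ∧ q ≤ p) := by
  obtain ⟨hmono, hties⟩ := Tuple.eq_sort_iff.1 (rfl : Tuple.sort u = Tuple.sort u)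
  have key : ∀ i j, i < j → u (Tuple.sort u i) < u (Tuple.sort u j) ∨
      (u (Tuple.sort u i) = u (Tuple.sort u j) ∧ Tuple.sort u i < Tuple.sort u j) := by
    intro i j hij
    rcases (hmono hij.le).lt_or_eq with h | h
    · exact Or.inl h
    · exact Or.inr ⟨h, hties i j hij h⟩
  obtain ⟨i, rfl⟩ := (Tuple.sort u).surjective p
  obtain ⟨j, rfl⟩ := (Tuple.sort u).surjective q
  simp only [Equiv.symm_apply_apply]
  constructor
  · intro h
    rcases h.lt_or_eq with h | rfl
    · exact (key _ _ h).imp id fun h => ⟨h.1, h.2.le⟩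
    · exact Or.inr ⟨rfl, le_rfl⟩
  · intro h
    by_contra! hij
    rcases key _ _ hij with h' | h' <;> rcases h with h | h
    · exact absurd h (not_lt.2 h'.le)
    · exact absurd h.1 h'.ne'
    · exact absurd h'.1 h.ne'
    · exact absurd h.2 (not_le.2 h'.2)

theorem sort_symm_val_add_one {n : ℕ} {α : Type*} [LinearOrder α] (u : Fin n → α) (p : Fin n) :
    ((Tuple.sort u).symm p : ℕ) + 1 =
      (univ.filter fun q => u q < u p ∨ (u q = u p ∧ q ≤ p)).card := by
  have : (univ.filter fun q => u q < u p ∨ (u q = u p ∧ q ≤ p)) =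
      (Iic ((Tuple.sort u).symm p)).map (Tuple.sort u).toEmbedding := by
    ext q
    simp [← sort_symm_le_iff]
  rw [this, card_map, Fin.card_Iic]

/-- The elements of `s`, taken in increasing order, have `0, 1, …, #s - 1` predecessors in `s`. -/
theorem prod_card_filter_lt {ι M : Type*} [LinearOrder ι] [CommMonoid M] (F : ℕ → M)
    (s : Finset ι) :
    ∏ t ∈ s, F (s.filter fun x => x < t).card = ∏ k ∈ range s.card, F k := by
  induction s using Finset.induction_on_max with
  | empty => simp
  | insert a s h ih =>
    have ha : a ∉ s := fun h' => lt_irrefl _ (h a h')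
    rw [prod_insert ha, card_insert_of_notMem ha, prod_range_succ, mul_comm, ← ih]
    congr 1
    · refine prod_congr rfl fun t ht => ?_
      rw [filter_insert, if_neg (not_lt.2 (h t ht).le)]
    · rw [filter_insert, if_neg (lt_irrefl a), filter_true_of_mem h]

/-- The number of cards dropped from packet `i`. -/
def dropCount {n a : ℕ} (g : Fin n → Fin a) (i : Fin a) : ℕ :=
  (univ.filter fun s => g s = i).card

theorem sum_dropCount {n a : ℕ} (g : Fin n → Fin a) : ∑ i, dropCount g i = n := by
  have := Finset.card_eq_sum_card_fiberwise (f := g) (s := univ) (t := univ) (by simp)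
  simpa [dropCount] using this.symm

theorem dropProb_eq {n a : ℕ} (A : Fin a → ℕ) (g : Fin n → Fin a) :
    dropProb A g = (∏ i, ((A i).descFactorial (dropCount g i) : ℝ)) / (n.factorial : ℝ) := by
  unfold dropProb
  rw [prod_div_distrib]
  congr 1
  · rw [← prod_fiberwise univ g]
    refine prod_congr rfl fun i _ => ?_
    have h := prod_card_filter_lt (fun k => ((A i - k : ℕ) : ℝ)) (univ.filter fun s => g s = i)
    rw [Nat.descFactorial_eq_prod_range, Nat.cast_prod, dropCount, ← h]
    refine prod_congr rfl fun t ht => ?_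
    simp only [mem_filter, mem_univ, true_and] at ht
    rw [ht, droppedBefore, filter_filter]
    simp only [and_comm]
  · rw [Fin.prod_univ_eq_prod_range (fun t => ((n - t : ℕ) : ℝ)) n, ← Nat.descFactorial_self,
      Nat.descFactorial_eq_prod_range, Nat.cast_prod]

/-- A drop order is possible only for packets of the right sizes, and then all of them together
with the cut have the same probability. -/
theorem cutProb_mul_dropProb {n a : ℕ} (A : Fin a → ℕ) (hA : ∑ i, A i = n) (g : Fin n → Fin a) :
    cutProb n A * dropProb A g = if A = dropCount g then 1 / (a : ℝ) ^ n else 0 := by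
  rw [dropProb_eq]
  split_ifs with h
  · have hfac : ∀ i, (A i).descFactorial (dropCount g i) = (A i).factorial := by
      intro i; rw [← h, Nat.descFactorial_self]
    simp only [hfac, cutProb]
    have h1 := Nat.multinomial_spec univ A
    rw [hA] at h1
    have h2 : (∏ i, ((A i).factorial : ℝ)) * (Nat.multinomial univ A : ℝ) = (n.factorial : ℝ) := by
      exact_mod_cast h1
    have h3 : (n.factorial : ℝ) ≠ 0 := by positivity
    rw [← h2] at h3 ⊢
    have := right_ne_zero_of_mul h3
    have := left_ne_zero_of_mul h3
    field_simp
  · obtain ⟨i, hi⟩ : ∃ i, A i < dropCount g i := by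
      by_contra! hle
      refine h (funext fun i => ?_)
      have hs : ∑ i, dropCount g i = ∑ i, A i := by rw [sum_dropCount, hA]
      exact ((sum_eq_sum_iff_of_le fun i _ => hle i).1 hs i (mem_univ i)).symm
    rw [prod_eq_zero (mem_univ i) (by rw [Nat.descFactorial_of_lt hi, Nat.cast_zero]),
      zero_div, mul_zero]

/-- Reading the packets from which the cards are dropped from the last to the first gives the
packets of the cards of the shuffled deck from top to bottom, and the shuffle is the inverse of
stably sorting the deck by packet. -/
theorem produces_dropCount_iff {n a : ℕ} (g : Fin n → Fin a) (σ : Equiv.Perm (Fin n)) :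
    Produces (dropCount g) g σ ↔ Tuple.sort (g ∘ Fin.rev) = σ := by
  have key : ∀ p : Fin n,
      ((Tuple.sort (g ∘ Fin.rev)).symm p : ℕ) + 1 + droppedBefore g p.rev (g p.rev) =
        ∑ j ∈ Iic (g p.rev), dropCount g j := by
    intro p
    rw [sort_symm_val_add_one]
    have h1 : ∑ j ∈ Iic (g p.rev), dropCount g j =
        (univ.filter fun q : Fin n => g q.rev ≤ g p.rev).card := by
      rw [card_eq_sum_card_fiberwise (f := fun q : Fin n => g q.rev) (t := Iic (g p.rev))]
      · refine sum_congr rfl fun j hj => ?_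
        rw [dropCount, ← card_map Fin.revPerm.toEmbedding]
        congr 1
        ext q
        simp only [mem_map_equiv, mem_filter, mem_univ, true_and, Fin.revPerm_symm,
          Fin.revPerm_apply]
        constructor
        · rintro rfl; exact ⟨mem_Iic.1 hj, rfl⟩
        · exact fun h => h.2
      · intro q hq; simpa using hq
    have h2 : droppedBefore g p.rev (g p.rev) =
        (univ.filter fun q : Fin n => p < q ∧ g q.rev = g p.rev).card := by
      rw [droppedBefore, ← card_map Fin.revPerm.toEmbedding]
      congr 1
      ext q
      simp only [mem_map_equiv, mem_filter, mem_univ, true_and, Fin.revPerm_symm,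
        Fin.revPerm_apply, Fin.rev_lt_rev]
    rw [h1, h2, ← card_union_of_disjoint]
    · congr 1
      ext q
      simp only [Function.comp, mem_union, mem_filter, mem_univ, true_and]
      rw [le_iff_lt_or_eq (a := g q.rev)]
      have := le_or_gt q p
      tauto
    · rw [disjoint_filter]
      rintro q - h ⟨h1, h2⟩
      rcases h with h | h
      · exact h.ne h2
      · exact absurd h.2 (not_le.2 h1)
  constructor
  · intro h
    refine Equiv.symm_bijective.1 (Equiv.ext fun p => Fin.ext ?_)
    have h1 := h p.rev
    have h2 := key p
    rw [Fin.rev_rev] at h1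
    omega
  · rintro rfl t
    simpa using key t.rev

/-- An `a`-shuffle is the stable sorting permutation of a uniformly random word in `a` letters. -/
theorem shuffle_eq (n a : ℕ) (σ : Equiv.Perm (Fin n)) :
    shuffle n a σ =
      ((univ.filter fun u : Fin n → Fin a => Tuple.sort u = σ).card : ℝ) / (a : ℝ) ^ n := by
  classical
  unfold shuffle
  rw [sum_comm]
  have h1 : ∀ g : Fin n → Fin a,
      (∑ A ∈ piAntidiag univ n, if Produces A g σ then cutProb n A * dropProb A g else 0) =
        if Tuple.sort (g ∘ Fin.rev) = σ then 1 / (a : ℝ) ^ n else 0 := by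
    intro g
    rw [sum_eq_single (dropCount g)]
    · rw [cutProb_mul_dropProb _ (sum_dropCount g), if_pos rfl]
      simp only [produces_dropCount_iff]
    · intro A hA hne
      rw [cutProb_mul_dropProb _ (by simpa using hA), if_neg hne, ite_self]
    · intro h
      simp [sum_dropCount] at h
  simp only [h1]
  rw [← (Equiv.arrowCongr (Fin.revPerm (n := n)) (Equiv.refl (Fin a))).sum_comp]
  have h2 : ∀ u : Fin n → Fin a,
      (Equiv.arrowCongr (Fin.revPerm (n := n)) (Equiv.refl (Fin a)) u) ∘ Fin.rev = u := by
    intro u; ext p; simp [Equiv.arrowCongr_apply]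
  simp only [h2]
  rw [← sum_filter, sum_const, nsmul_eq_mul, mul_one_div]

/-! ### Convolution of shuffles -/

/-- Sorting by a word `v` and then by a word `u` is sorting by pairs of letters, the letter of `u`
being the more significant one. -/
theorem sort_toLex {n : ℕ} {α β : Type*} [LinearOrder α] [LinearOrder β]
    (u : Fin n → α) (v : Fin n → β) :
    Tuple.sort (fun p => toLex (u ((Tuple.sort v).symm p), v p)) =
      Tuple.sort v * Tuple.sort u := by
  obtain ⟨hu, hu'⟩ := Tuple.eq_sort_iff.1 (rfl : Tuple.sort u = Tuple.sort u)
  obtain ⟨hv, hv'⟩ := Tuple.eq_sort_iff.1 (rfl : Tuple.sort v = Tuple.sort v)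
  symm
  rw [Tuple.eq_sort_iff]
  constructor
  · intro i j hij
    rcases hij.lt_or_eq with hij | rfl
    · simp only [Function.comp, Equiv.Perm.mul_apply, Equiv.symm_apply_apply]
      rw [Prod.Lex.toLex_le_toLex]
      rcases (hu hij.le).lt_or_eq with h | h
      · exact Or.inl h
      · exact Or.inr ⟨h, hv (hu' i j hij h).le⟩
    · exact le_rfl
  · intro i j hij h
    simp only [Equiv.Perm.mul_apply, Equiv.symm_apply_apply, toLex_inj, Prod.mk.injEq] at h ⊢
    exact hv' _ _ (hu' i j hij h.1) h.2

theorem card_sort_lex {n : ℕ} {α β : Type*} [LinearOrder α] [LinearOrder β] [Fintype α]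
    [Fintype β] (σ : Equiv.Perm (Fin n)) :
    ∑ τ : Equiv.Perm (Fin n), (univ.filter fun u : Fin n → α => Tuple.sort u = τ).card *
        (univ.filter fun v : Fin n → β => Tuple.sort v = σ * τ⁻¹).card =
      (univ.filter fun z : Fin n → α ×ₗ β => Tuple.sort z = σ).card := by
  have h1 : (univ.filter fun z : Fin n → α ×ₗ β => Tuple.sort z = σ).card =
      (univ.filter fun x : (Fin n → α) × (Fin n → β) =>
        Tuple.sort x.2 * Tuple.sort x.1 = σ).card := by
    symm
    refine card_nbij' (fun x p => toLex (x.1 ((Tuple.sort x.2).symm p), x.2 p))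
      (fun z => (fun p => (ofLex (z (Tuple.sort (fun q => (ofLex (z q)).2) p))).1,
        fun p => (ofLex (z p)).2)) ?_ ?_ ?_ ?_
    · intro x hx
      simpa [sort_toLex] using hx
    · intro z hz
      simp only [coe_filter, mem_univ, true_and, Set.mem_ofPred_eq] at hz ⊢
      rw [← sort_toLex, ← hz]
      simp
    · intro x _
      simp
    · intro z _
      simp
  rw [h1, card_eq_sum_card_fiberwise (f := fun x => Tuple.sort x.1) (t := univ) (by simp)]
  refine sum_congr rfl fun τ _ => ?_
  rw [← card_product]
  congr 1
  ext x
  simp only [mem_product, mem_filter, mem_univ, true_and]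
  constructor
  · rintro ⟨rfl, h⟩
    exact ⟨by rw [h, inv_mul_cancel_right], rfl⟩
  · rintro ⟨h, rfl⟩
    exact ⟨rfl, by rw [← h, mul_inv_cancel_right]⟩

theorem card_sort_congr {n : ℕ} {α β : Type*} [LinearOrder α] [LinearOrder β] [Fintype α]
    [Fintype β] (e : α ≃o β) (σ : Equiv.Perm (Fin n)) :
    (univ.filter fun u : Fin n → α => Tuple.sort u = σ).card =
      (univ.filter fun u : Fin n → β => Tuple.sort u = σ).card := by
  refine card_equiv (Equiv.arrowCongr (Equiv.refl _) e.toEquiv) fun u => ?_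
  have : Tuple.sort u = Tuple.sort (e ∘ u) := by
    rw [Tuple.eq_sort_iff]
    obtain ⟨h1, h2⟩ := Tuple.eq_sort_iff.1 (rfl : Tuple.sort u = Tuple.sort u)
    exact ⟨e.monotone.comp h1, fun i j hij h => h2 i j hij (e.injective h)⟩
  simp only [mem_filter, mem_univ, true_and, this]
  rfl

/-- An `a`-shuffle followed by a `b`-shuffle is an `ab`-shuffle. -/
theorem shuffle_conv (n a b : ℕ) (σ : Equiv.Perm (Fin n)) :
    ∑ τ : Equiv.Perm (Fin n), shuffle n a τ * shuffle n b (σ * τ⁻¹) = shuffle n (a * b) σ := by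
  have e : Fin a ×ₗ Fin b ≃o Fin (a * b) :=
    (Fintype.orderIsoFinOfCardEq (Fin a ×ₗ Fin b) (by simp)).symm
  simp only [shuffle_eq]
  rw [← card_sort_congr e, ← card_sort_lex, Nat.cast_sum, sum_div]
  refine sum_congr rfl fun τ _ => ?_
  push_cast
  rw [mul_pow, div_mul_div_comm]

theorem convPow_shuffle (n a k : ℕ) : convPow (shuffle n a) k = shuffle n (a ^ k) := by
  induction k with
  | zero =>
    funext σ
    have h : ∀ u : Fin n → Fin 1, Tuple.sort u = 1 := fun u =>
      Tuple.sort_eq_refl_iff_monotone.2 fun i j _ => (Subsingleton.elim _ _).le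
    simp only [convPow, shuffle_eq, pow_zero, h, eq_comm (a := σ)]
    split_ifs <;> simp [*]
  | succ k ih =>
    funext σ
    simp only [convPow]
    rw [ih, shuffle_conv, pow_succ']

/-! ### The least likely configuration -/

theorem configProb_shuffle {n m : ℕ} (a : ℕ) (w v : Fin n → Fin m) :
    configProb (shuffle n a) w v =
      ((univ.filter fun u : Fin n → Fin a => rearrange w (Tuple.sort u) = v).card : ℝ) /
        (a : ℝ) ^ n := by
  unfold configProb
  simp only [shuffle_eq]
  rw [← sum_div, ← Nat.cast_sum]
  congr 2
  rw [card_eq_sum_card_fiberwise (f := fun u : Fin n → Fin a => Tuple.sort u)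
    (t := univ.filter fun σ => rearrange w σ = v)]
  · refine sum_congr rfl fun σ hσ => ?_
    rw [filter_filter]
    congr 1
    ext u
    simp only [mem_filter, mem_univ, true_and] at hσ ⊢
    constructor
    · rintro rfl; exact ⟨hσ, rfl⟩
    · exact fun h => h.2
  · intro u hu
    simpa using hu

/-- A word produces the configuration `v` from a sorted deck exactly when cards of different
types are ranked by their types. -/
theorem rearrange_sort_eq_iff {n m : ℕ} {α : Type*} [LinearOrder α] {w : Fin n → Fin m}
    (hw : Monotone w) (ρ : Equiv.Perm (Fin n)) (u : Fin n → α) :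
    rearrange w (Tuple.sort u) = rearrange w ρ ↔
      ∀ p q, rearrange w ρ p < rearrange w ρ q → u p < u q ∨ (u p = u q ∧ p < q) := by
  have hlt : ∀ p q, (Tuple.sort u).symm p < (Tuple.sort u).symm q ↔
      u p < u q ∨ (u p = u q ∧ p < q) := by
    intro p q
    rw [← not_le, sort_symm_le_iff]
    rcases lt_trichotomy (u p) (u q) with h | h | h
    · simp [h, h.ne', not_lt.2 h.le]
    · simp [h]
    · simp [h, h.ne', not_lt.2 h.le]
  constructor
  · intro h p q hpq
    rw [← h] at hpq
    exact (hlt p q).1 (hw.reflect_lt hpq)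
  · intro h
    have h1 : Monotone (w ∘ (ρ.symm * Tuple.sort u : Equiv.Perm (Fin n))) := by
      intro i j hij
      by_contra! hlt'
      have h2 := (hlt _ _).2 (h _ _ hlt')
      simp only [Equiv.symm_apply_apply] at h2
      exact absurd hij (not_le.2 h2)
    have h2 := Tuple.unique_monotone (σ := 1) (by simpa using hw) h1
    funext p
    have h3 := congrFun h2 ((Tuple.sort u).symm p)
    simpa [rearrange] using h3

/-- The words in `a` letters in which cards of a smaller type carry smaller letters than cards of
a larger type.  Up to reversal of the positions, they are the words that reverse the types of a
sorted deck. -/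
def strictWords {n m : ℕ} (w : Fin n → Fin m) (a : ℕ) : Finset (Fin n → Fin a) :=
  univ.filter fun u => ∀ p q, w p < w q → u p < u q

theorem card_strictWords_le {n m : ℕ} {w : Fin n → Fin m} (hw : Monotone w) (a : ℕ)
    (ρ : Equiv.Perm (Fin n)) :
    (strictWords w a).card ≤
      (univ.filter fun u : Fin n → Fin a =>
        rearrange w (Tuple.sort u) = rearrange w ρ).card := by
  refine card_le_card_of_injOn (fun u => u ∘ ρ.symm) ?_ ?_
  · intro u hu
    simp only [strictWords, coe_filter, mem_univ, true_and, Set.mem_ofPred_eq] at hu ⊢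
    rw [rearrange_sort_eq_iff hw]
    exact fun p q h => Or.inl (hu _ _ h)
  · intro u _ v _ h
    exact ρ.symm.surjective.injective_comp_right h

theorem card_strictWords_eq {n m : ℕ} {w : Fin n → Fin m} (hw : Monotone w) (a : ℕ) :
    (univ.filter fun u : Fin n → Fin a =>
        rearrange w (Tuple.sort u) = rearrange w Fin.revPerm).card =
      (strictWords w a).card := by
  refine card_equiv (Equiv.arrowCongr Fin.revPerm (Equiv.refl _)) fun u => ?_
  simp only [strictWords, mem_filter, mem_univ, true_and, rearrange_sort_eq_iff hw, rearrange,
    Fin.revPerm_symm, Fin.revPerm_apply, Equiv.arrowCongr_apply, Function.comp, Equiv.refl_apply]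
  constructor
  · intro h p q hpq
    have h1 := h p.rev q.rev
    simp only [Fin.rev_rev, Fin.rev_lt_rev] at h1
    rcases h1 hpq with h2 | h2
    · exact h2
    · exact absurd (hw.reflect_lt hpq) (not_lt.2 h2.2.le)
  · intro h p q hpq
    have h1 := h p.rev q.rev hpq
    simp only [Fin.rev_rev] at h1
    exact Or.inl h1

/-- The reversed deck is the least likely configuration after an `a`-shuffle. -/
theorem separation_shuffle {n m : ℕ} {w : Fin n → Fin m} (hw : Monotone w) (a : ℕ) :
    separation (shuffle n a) w =
      1 - ((configurations w).card : ℝ) * (((strictWords w a).card : ℝ) / (a : ℝ) ^ n) := by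
  have hU : ∀ x : ℝ, x / (1 / ((configurations w).card : ℝ)) =
      ((configurations w).card : ℝ) * x := fun x => by rw [div_div_eq_mul_div, div_one, mul_comm]
  unfold separation
  simp only [hU]
  apply le_antisymm
  · refine sup'_le _ _ fun v hv => ?_
    obtain ⟨ρ, -, rfl⟩ := mem_image.1 hv
    have := card_strictWords_le hw a ρ
    rw [configProb_shuffle]
    gcongr
  · rw [← card_strictWords_eq hw, ← configProb_shuffle]
    exact le_sup' (fun v => 1 - ((configurations w).card : ℝ) * configProb (shuffle n a) w v)
      (mem_image_of_mem _ (mem_univ Fin.revPerm))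

/-- The number of configurations is a multinomial coefficient. -/
theorem card_configurations {n m : ℕ} (w : Fin n → Fin m) :
    (configurations w).card * ∏ i, ((univ.filter fun p => w p = i).card).factorial =
      n.factorial := by
  have h1 : ∀ v ∈ configurations w,
      (univ.filter fun σ : Equiv.Perm (Fin n) => rearrange w σ = v).card =
        ∏ i, ((univ.filter fun p => w p = i).card).factorial := by
    intro v hv
    obtain ⟨ρ, -, rfl⟩ := mem_image.1 hv
    have h2 := DomMulAct.stabilizer_card w
    simp only [Fintype.card_subtype] at h2
    rw [← h2]
    refine card_nbij' (fun σ => ρ.symm * σ) (fun σ => ρ * σ) ?_ ?_ ?_ ?_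
    · intro σ hσ
      simp only [coe_filter, mem_univ, true_and, Set.mem_ofPred_eq] at hσ ⊢
      funext p
      have := congrFun hσ (σ p)
      simpa [rearrange] using this.symm
    · intro σ hσ
      simp only [coe_filter, mem_univ, true_and, Set.mem_ofPred_eq] at hσ ⊢
      funext p
      have := congrFun hσ (σ.symm (ρ.symm p))
      simp only [Function.comp, Equiv.apply_symm_apply] at this
      exact this.symm
    · intro σ _
      ext; simp
    · intro σ _
      ext; simp
  have h2 := card_eq_sum_card_image (rearrange w) (univ : Finset (Equiv.Perm (Fin n)))
  rw [card_univ, Fintype.card_perm, Fintype.card_fin] at h2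
  rw [h2, ← smul_eq_mul, ← sum_const]
  exact sum_congr rfl fun v hv => (h1 v hv).symm

/-! ### The number of words that reverse the deck -/

/-- The number of ways to write letters `1, …, b` on `D i` cards of each type `i`, for `j + 1`
types, so that the letters of each type are smaller than those of the next: `k + 1` is the
largest letter on the cards of the first type. -/
def strictCount : (j : ℕ) → (Fin (j + 1) → ℕ) → ℕ → ℝ
  | 0, D, b => (b : ℝ) ^ D 0
  | j + 1, D, b => ∑ k ∈ range b,
      (((k : ℝ) + 1) ^ D 0 - (k : ℝ) ^ D 0) * strictCount j (Fin.tail D) (b - (k + 1))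

/-- The families of letters in `[c, a)`, `D i` of each type `i`, such that the letters of each type
are smaller than those of the larger types. -/
def strictFamilies {m : ℕ} (D : Fin m → ℕ) (c a : ℕ) : Finset ((i : Fin m) → Fin (D i) → ℕ) :=
  (Fintype.piFinset fun _ => Fintype.piFinset fun _ => Ico c a).filter
    fun u => ∀ i j, i < j → ∀ p q, u i p < u j q

theorem mem_strictFamilies {m : ℕ} {D : Fin m → ℕ} {c a : ℕ} {u : (i : Fin m) → Fin (D i) → ℕ} :
    u ∈ strictFamilies D c a ↔
      (∀ i p, c ≤ u i p ∧ u i p < a) ∧ ∀ i j, i < j → ∀ p q, u i p < u j q := by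
  simp [strictFamilies, Fintype.mem_piFinset]

theorem card_filter_sup_eq {r c k : ℕ} (hr : 0 < r) :
    (((Fintype.piFinset fun _ : Fin r => Ico c (k + 1)).filter
      fun v => univ.sup v = k).card : ℝ) = ((k + 1 - c : ℕ) : ℝ) ^ r - ((k - c : ℕ) : ℝ) ^ r := by
  have h : ((Fintype.piFinset fun _ : Fin r => Ico c (k + 1)).filter fun v => univ.sup v = k) =
      (Fintype.piFinset fun _ : Fin r => Ico c (k + 1)) \
        (Fintype.piFinset fun _ : Fin r => Ico c k) := by
    ext v
    simp only [mem_filter, mem_sdiff, Fintype.mem_piFinset, mem_Ico]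
    refine and_congr_right fun hv => ?_
    have hle : univ.sup v ≤ k := Finset.sup_le fun p _ => Nat.lt_succ_iff.1 (hv p).2
    have hne : (univ : Finset (Fin r)).Nonempty := ⟨⟨0, hr⟩, mem_univ _⟩
    constructor
    · intro hs hv'
      obtain ⟨p, -, hp⟩ := exists_mem_eq_sup univ hne v
      have := (hv' p).2
      omega
    · intro hv'
      by_contra hs
      refine hv' fun p => ⟨(hv p).1, ?_⟩
      have : v p ≤ univ.sup v := le_sup (mem_univ p)
      omega
  have hsub : (Fintype.piFinset fun _ : Fin r => Ico c k) ⊆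
      (Fintype.piFinset fun _ : Fin r => Ico c (k + 1)) :=
    Fintype.piFinset_subset _ _ fun _ => Ico_subset_Ico_right (Nat.le_succ k)
  rw [h, cast_card_sdiff hsub]
  simp

theorem card_strictFamilies_succ {m : ℕ} (D : Fin (m + 1) → ℕ) (hD : 0 < D 0) {c a : ℕ} :
    ((strictFamilies D c a).card : ℝ) = ∑ k ∈ Ico c a,
      (((k + 1 - c : ℕ) : ℝ) ^ D 0 - ((k - c : ℕ) : ℝ) ^ D 0) *
        ((strictFamilies (Fin.tail D) (k + 1) a).card : ℝ) := by
  have hne : (univ : Finset (Fin (D 0))).Nonempty := ⟨⟨0, hD⟩, mem_univ _⟩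
  rw [card_eq_sum_card_fiberwise (f := fun u => univ.sup (u 0)) (t := Ico c a), Nat.cast_sum]
  · refine sum_congr rfl fun k hk => ?_
    rw [mem_Ico] at hk
    rw [← card_filter_sup_eq hD, ← Nat.cast_mul, ← card_product]
    congr 1
    refine card_equiv (Fin.insertNthEquiv (fun i => Fin (D i) → ℕ) 0).symm fun u => ?_
    simp only [mem_filter, mem_strictFamilies, mem_product, Fintype.mem_piFinset, mem_Ico]
    simp only [Fin.insertNthEquiv_zero]
    constructor
    · rintro ⟨⟨h1, h2⟩, h3⟩
      have hle : ∀ p, u 0 p ≤ k := fun p => h3 ▸ le_sup (f := u 0) (mem_univ p)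
      obtain ⟨p, -, hp⟩ := exists_mem_eq_sup univ hne (u 0)
      refine ⟨⟨fun p => ⟨(h1 0 p).1, Nat.lt_succ_iff.2 (hle p)⟩, h3⟩,
        fun i q => ⟨?_, (h1 i.succ q).2⟩,
        fun i j hij p q => h2 _ _ (Fin.succ_lt_succ_iff.2 hij) p q⟩
      have := h2 0 i.succ (Fin.succ_pos i) p q
      change k + 1 ≤ u i.succ q
      omega
    · rintro ⟨⟨h1, h2⟩, h3, h4⟩
      have hle : ∀ p, u 0 p ≤ k := fun p => Nat.lt_succ_iff.1 (h1 p).2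
      refine ⟨⟨fun i => ?_, fun i => ?_⟩, h2⟩
      · refine Fin.cases (fun p => ⟨(h1 p).1, (hle p).trans_lt hk.2⟩) (fun i q => ?_) i
        have := (h3 i q)
        exact ⟨hk.1.trans ((Nat.le_succ k).trans this.1), this.2⟩
      · refine Fin.cases (fun j => ?_) (fun i j => ?_) i
        · refine Fin.cases (fun h => absurd h (lt_irrefl _)) (fun j _ p q => ?_) j
          exact (Nat.lt_succ_iff.2 (hle p)).trans_le (h3 j q).1
        · refine Fin.cases (fun h => absurd h (Fin.not_lt_zero _)) (fun j h p q => ?_) j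
          exact h4 i j (Fin.succ_lt_succ_iff.1 h) p q
  · intro u hu
    obtain ⟨h1, -⟩ := mem_strictFamilies.1 hu
    obtain ⟨p, -, hp⟩ := exists_mem_eq_sup univ hne (u 0)
    simp only [hp]
    exact mem_coe.2 (mem_Ico.2 (h1 0 p))

theorem card_strictFamilies (j : ℕ) (D : Fin (j + 1) → ℕ) (hD : ∀ i, 0 < D i) (c a : ℕ) :
    ((strictFamilies D c a).card : ℝ) = strictCount j D (a - c) := by
  induction j generalizing c with
  | zero =>
    rw [strictFamilies, filter_true_of_mem]
    · simp [strictCount]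
    · intro u _ i j hij
      omega
  | succ j ih =>
    rw [card_strictFamilies_succ D (hD 0), strictCount, sum_Ico_eq_sum_range]
    refine sum_congr rfl fun k _ => ?_
    rw [ih (Fin.tail D) (fun i => hD i.succ), show c + k + 1 - c = k + 1 by omega,
      show c + k - c = k by omega, show a - (c + k + 1) = a - c - (k + 1) by omega]
    push_cast
    rfl

theorem card_strictWords {n j : ℕ} (w : Fin n → Fin (j + 1)) (D : Fin (j + 1) → ℕ)
    (hw : ∀ i, (univ.filter fun p => w p = i).card = D i) (hD : ∀ i, 0 < D i) (a : ℕ) :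
    ((strictWords w a).card : ℝ) = strictCount j D a := by
  have hcard : ∀ i, Fintype.card {p // w p = i} = D i := fun i => by
    rw [Fintype.card_subtype, hw]
  have e : ∀ i, {p // w p = i} ≃ Fin (D i) := fun i => Fintype.equivFinOfCardEq (hcard i)
  have h := card_strictFamilies j D hD 0 a
  rw [Nat.sub_zero] at h
  rw [← h]
  congr 1
  refine card_bij (fun u _ i p => (u ((e i).symm p).1 : ℕ)) ?_ ?_ ?_
  · intro u hu
    simp only [strictWords, mem_filter, mem_univ, true_and] at hu
    rw [mem_strictFamilies]
    refine ⟨fun i p => ⟨Nat.zero_le _, Fin.is_lt _⟩, fun i j hij p q => hu _ _ ?_⟩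
    rw [((e i).symm p).2, ((e j).symm q).2]
    exact hij
  · intro u _ v _ huv
    funext p
    have := congrFun (congrFun huv (w p)) (e (w p) ⟨p, rfl⟩)
    simpa [Fin.val_inj] using this
  · intro x hx
    obtain ⟨h1, h2⟩ := mem_strictFamilies.1 hx
    refine ⟨fun p => ⟨x (w p) (e (w p) ⟨p, rfl⟩), (h1 _ _).2⟩, ?_, ?_⟩
    · simp only [strictWords, mem_filter, mem_univ, true_and]
      exact fun p q hpq => h2 _ _ hpq _ _
    · funext i p
      have key : ∀ q : {p // w p = i}, x (w q) (e (w q) ⟨q, rfl⟩) = x i (e i q) := by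
        rintro ⟨q, rfl⟩; rfl
      exact (key ((e i).symm p)).trans (by simp)

/-- With fewer letters than types there is no word that reverses the deck. -/
theorem strictCount_eq_zero (j : ℕ) (D : Fin (j + 1) → ℕ) (hD : ∀ i, 0 < D i) {b : ℕ}
    (hb : b ≤ j) : strictCount j D b = 0 := by
  induction j generalizing b with
  | zero => simp [strictCount, Nat.le_zero.1 hb, (hD 0).ne']
  | succ j ih =>
    refine sum_eq_zero fun k hk => ?_
    rw [ih (Fin.tail D) (fun i => hD i.succ) (by have := mem_range.1 hk; omega), mul_zero]

/-! ### Sums and integrals of products of truncated powers -/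

/-- The normalized truncated power `y₊ ^ r / r!`. -/
noncomputable def truncPow (r : ℕ) (y : ℝ) : ℝ := if 0 ≤ y then y ^ r / (r.factorial : ℝ) else 0

theorem truncPow_of_nonneg (r : ℕ) {y : ℝ} (hy : 0 ≤ y) :
    truncPow r y = y ^ r / (r.factorial : ℝ) := if_pos hy

theorem truncPow_of_neg (r : ℕ) {y : ℝ} (hy : y < 0) : truncPow r y = 0 := if_neg (not_le.2 hy)

theorem truncPow_of_nonpos {r : ℕ} (hr : r ≠ 0) {y : ℝ} (hy : y ≤ 0) : truncPow r y = 0 := by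
  rcases hy.lt_or_eq with h | rfl
  · exact truncPow_of_neg r h
  · rw [truncPow_of_nonneg r le_rfl, zero_pow hr, zero_div]

theorem truncPow_nonneg (r : ℕ) (y : ℝ) : 0 ≤ truncPow r y := by
  unfold truncPow
  split_ifs with h
  · positivity
  · exact le_rfl

theorem truncPow_mono (r : ℕ) : Monotone (truncPow r) := by
  intro x y hxy
  rcases lt_or_ge x 0 with hx | hx
  · rw [truncPow_of_neg r hx]
    exact truncPow_nonneg r y
  · rw [truncPow_of_nonneg r hx, truncPow_of_nonneg r (hx.trans hxy)]
    gcongr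

theorem truncPow_eq_max {r : ℕ} (hr : r ≠ 0) :
    truncPow r = fun y => max y 0 ^ r / (r.factorial : ℝ) := by
  funext y
  rcases le_total 0 y with h | h
  · rw [truncPow_of_nonneg r h, max_eq_left h]
  · rw [truncPow_of_nonpos hr h, max_eq_right h, zero_pow hr, zero_div]

theorem continuous_truncPow {r : ℕ} (hr : r ≠ 0) : Continuous (truncPow r) := by
  rw [truncPow_eq_max hr]
  fun_prop

theorem measurable_truncPow (r : ℕ) : Measurable (truncPow r) := (truncPow_mono r).measurable

theorem abs_truncPow_le (r : ℕ) (y : ℝ) : |truncPow r y| ≤ |y| ^ r := by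
  rcases lt_or_ge y 0 with hy | hy
  · rw [truncPow_of_neg r hy, abs_zero]
    positivity
  · rw [truncPow_of_nonneg r hy, abs_div, abs_pow, Nat.abs_cast]
    exact div_le_self (by positivity) (by exact_mod_cast r.factorial_pos)

theorem hasDerivAt_truncPow (r : ℕ) {y : ℝ} (hy : y ≠ 0) :
    HasDerivAt (truncPow (r + 1)) (truncPow r y) y := by
  rcases hy.lt_or_gt with h | h
  · rw [truncPow_of_neg r h]
    refine (hasDerivAt_const y (0 : ℝ)).congr_of_eventuallyEq ?_
    filter_upwards [Iio_mem_nhds h] with z hz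
    exact truncPow_of_neg _ hz
  · rw [truncPow_of_nonneg r h.le]
    have h1 : HasDerivAt (fun z : ℝ => z ^ (r + 1) / ((r + 1).factorial : ℝ))
        (y ^ r / (r.factorial : ℝ)) y := by
      refine ((hasDerivAt_pow (r + 1) y).div_const ((r + 1).factorial : ℝ)).congr_deriv ?_
      rw [Nat.factorial_succ]
      have : (r.factorial : ℝ) ≠ 0 := by positivity
      push_cast
      field_simp
    refine h1.congr_of_eventuallyEq ?_
    filter_upwards [Ioi_mem_nhds h] with z hz
    exact truncPow_of_nonneg _ (le_of_lt hz)

theorem hasDerivAt_truncPow_sub (r : ℕ) {x y : ℝ} (hy : y ≠ x) :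
    HasDerivAt (fun z => truncPow (r + 1) (x - z)) (-truncPow r (x - y)) y := by
  exact ((hasDerivAt_truncPow r (sub_ne_zero.2 hy.symm)).comp y
    ((hasDerivAt_id y).const_sub x)).congr_deriv (by ring)

theorem intervalIntegrable_truncPow_mul (r s : ℕ) (x a b : ℝ) :
    IntervalIntegrable (fun y => truncPow r y * truncPow s (x - y)) MeasureTheory.volume a b := by
  have hc : Continuous fun y : ℝ => |y| ^ r * |x - y| ^ s := by fun_prop
  refine (hc.intervalIntegrable a b).mono_fun ?_ ?_
  · exact ((measurable_truncPow r).mul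
      ((measurable_truncPow s).comp (measurable_const.sub measurable_id))).aestronglyMeasurable
  · refine Filter.Eventually.of_forall fun y => ?_
    simp only [Real.norm_eq_abs, abs_mul, abs_pow, abs_abs]
    exact mul_le_mul (abs_truncPow_le r y) (abs_truncPow_le s _) (abs_nonneg _) (by positivity)

/-- The Beta integral: truncated powers are closed under convolution. -/
theorem integral_truncPow_mul (r s : ℕ) {x a b : ℝ} (ha : a ≤ 0) (hb : x ≤ b) :
    ∫ y in a..b, truncPow r y * truncPow s (x - y) = truncPow (r + s + 1) x := by
  induction s generalizing r with
  | zero =>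
    rw [MeasureTheory.integral_eq_of_hasDerivAt_off_countable
      (fun y => truncPow (r + 1) (min y x)) _ (s := {0, x}) (Set.toFinite _).countable]
    · rw [min_eq_right hb, truncPow_of_nonpos (by omega) ((min_le_left a x).trans ha)]
      simp
    · exact ((continuous_truncPow (by omega)).comp (by fun_prop)).continuousOn
    · rintro y ⟨-, hy⟩
      simp only [Set.mem_insert_iff, Set.mem_singleton_iff, not_or] at hy
      rcases lt_or_gt_of_ne hy.2 with h | h
      · rw [truncPow_of_nonneg 0 (sub_nonneg.2 h.le)]
        simp only [pow_zero, Nat.factorial_zero, Nat.cast_one, div_one, mul_one]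
        refine (hasDerivAt_truncPow r hy.1).congr_of_eventuallyEq ?_
        filter_upwards [Iio_mem_nhds h] with z hz
        rw [min_eq_left (le_of_lt hz)]
      · rw [truncPow_of_neg 0 (sub_neg.2 h), mul_zero]
        refine (hasDerivAt_const y (truncPow (r + 1) x)).congr_of_eventuallyEq ?_
        filter_upwards [Ioi_mem_nhds h] with z hz
        rw [min_eq_right (le_of_lt hz)]
    · exact intervalIntegrable_truncPow_mul r 0 x a b
  | succ s ih =>
    have h1 : ∫ y in a..b, (truncPow r y * truncPow (s + 1) (x - y) -
        truncPow (r + 1) y * truncPow s (x - y)) = 0 := by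
      rw [MeasureTheory.integral_eq_of_hasDerivAt_off_countable
        (fun y => truncPow (r + 1) y * truncPow (s + 1) (x - y)) _ (s := {0, x})
        (Set.toFinite _).countable]
      · rw [truncPow_of_nonpos (r := s + 1) (y := x - b) (by omega) (by linarith),
          truncPow_of_nonpos (r := r + 1) (y := a) (by omega) ha]
        simp
      · have h1 := continuous_truncPow (r := r + 1) (by omega)
        have h2 := continuous_truncPow (r := s + 1) (by omega)
        exact (h1.mul (h2.comp (by fun_prop))).continuousOn
      · rintro y ⟨-, hy⟩
        simp only [Set.mem_insert_iff, Set.mem_singleton_iff, not_or] at hy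
        exact ((hasDerivAt_truncPow r hy.1).mul
          (hasDerivAt_truncPow_sub s hy.2)).congr_deriv (by ring)
      · exact (intervalIntegrable_truncPow_mul r (s + 1) x a b).sub
          (intervalIntegrable_truncPow_mul (r + 1) s x a b)
    rw [intervalIntegral.integral_sub (intervalIntegrable_truncPow_mul r (s + 1) x a b)
      (intervalIntegrable_truncPow_mul (r + 1) s x a b), sub_eq_zero] at h1
    rw [h1, ih]
    congr 1
    omega

/-- The trapezoidal rule on a unit interval, with a one-sided bound `-q ≤ h''` on the second
derivative. -/
theorem trapezoid_bounds {h h' h'' q : ℝ → ℝ} {S : Set ℝ} (hS : S.Countable)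
    (hc : Continuous h) (hc' : Continuous h')
    (hd : ∀ y, y ∉ S → HasDerivAt h (h' y) y) (hd' : ∀ y, y ∉ S → HasDerivAt h' (h'' y) y)
    (hi : ∀ a b, IntervalIntegrable h'' MeasureTheory.volume a b)
    (hq : ∀ a b, IntervalIntegrable q MeasureTheory.volume a b)
    (hq0 : ∀ y, 0 ≤ q y) (hqh : ∀ y, -q y ≤ h'' y) (c : ℝ) :
    -(1 / 8) * (∫ y in c..c + 1, q y) ≤ (h c + h (c + 1)) / 2 - ∫ y in c..c + 1, h y ∧
    (h c + h (c + 1)) / 2 - (∫ y in c..c + 1, h y) ≤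
      1 / 8 * (∫ y in c..c + 1, q y) + 1 / 8 * (h' (c + 1) - h' c) := by
  set K : ℝ → ℝ := fun y => (y - c) * (c + 1 - y) / 2 with hK
  have hKc : Continuous K := by fun_prop
  have hKi : IntervalIntegrable (fun y => K y * h'' y) MeasureTheory.volume c (c + 1) :=
    (hi c (c + 1)).continuousOn_mul hKc.continuousOn
  have hhi : IntervalIntegrable h MeasureTheory.volume c (c + 1) := hc.intervalIntegrable _ _
  have hcc : c ≤ c + 1 := by linarith
  -- Integrating by parts twice against the kernel `(y - c) (c + 1 - y) / 2`.
  have key : (∫ y in c..c + 1, K y * h'' y) + ∫ y in c..c + 1, h y = (h c + h (c + 1)) / 2 := by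
    rw [← intervalIntegral.integral_add hKi hhi,
      MeasureTheory.integral_eq_of_hasDerivAt_off_countable
        (fun y => K y * h' y - (c + 1 / 2 - y) * h y) _ hS]
    · simp only [hK]; ring
    · exact (by fun_prop : Continuous fun y => K y * h' y - (c + 1 / 2 - y) * h y).continuousOn
    · rintro y ⟨-, hy⟩
      have h1 : HasDerivAt K (c + 1 / 2 - y) y := by
        exact ((((hasDerivAt_id y).sub_const c).mul
          ((hasDerivAt_id y).const_sub (c + 1))).div_const 2).congr_deriv (by simp only [id]; ring)
      have h2 : HasDerivAt (fun y : ℝ => c + 1 / 2 - y) (-1) y :=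
        (hasDerivAt_id y).const_sub (c + 1 / 2)
      exact ((h1.mul (hd' y hy)).sub (h2.mul (hd y hy))).congr_deriv (by ring)
    · exact hKi.add hhi
  have hKb : ∀ y ∈ Set.Icc c (c + 1), 0 ≤ K y ∧ K y ≤ 1 / 8 := by
    rintro y ⟨h1, h2⟩
    constructor
    · exact div_nonneg (mul_nonneg (by linarith) (by linarith)) (by norm_num)
    · simp only [hK]; nlinarith [sq_nonneg (y - c - 1 / 2)]
  have hder : ∫ y in c..c + 1, h'' y = h' (c + 1) - h' c :=
    MeasureTheory.integral_eq_of_hasDerivAt_off_countable h' h'' hS hc'.continuousOn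
      (fun y hy => hd' y hy.2) (hi _ _)
  have lower : -(1 / 8) * (∫ y in c..c + 1, q y) ≤ ∫ y in c..c + 1, K y * h'' y := by
    rw [← intervalIntegral.integral_const_mul]
    refine intervalIntegral.integral_mono_on hcc ((hq _ _).const_mul _) hKi fun y hy => ?_
    obtain ⟨h1, h2⟩ := hKb y hy
    nlinarith [hq0 y, hqh y, mul_nonneg h1 (by linarith [hqh y] : 0 ≤ h'' y + q y),
      mul_nonneg (sub_nonneg.2 h2) (hq0 y)]
  have upper : (∫ y in c..c + 1, K y * h'' y) ≤
      1 / 8 * (∫ y in c..c + 1, q y) + 1 / 8 * (h' (c + 1) - h' c) := by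
    rw [← hder, ← intervalIntegral.integral_const_mul, ← intervalIntegral.integral_const_mul,
      ← intervalIntegral.integral_add ((hq _ _).const_mul _) ((hi _ _).const_mul _)]
    refine intervalIntegral.integral_mono_on hcc hKi
      (((hq _ _).const_mul _).add ((hi _ _).const_mul _)) fun y hy => ?_
    obtain ⟨h1, h2⟩ := hKb y hy
    nlinarith [hq0 y, hqh y, mul_nonneg h1 (hq0 y),
      mul_nonneg (sub_nonneg.2 h2) (by linarith [hqh y] : 0 ≤ h'' y + q y)]
  constructor <;> linarith

/-- The second derivative is only bounded below; the upper bound on the error comes from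
`∫ h'' = 0`. -/
theorem abs_sum_sub_integral_le {h h' h'' q : ℝ → ℝ} {S : Set ℝ} (hS : S.Countable)
    (hc : Continuous h) (hc' : Continuous h')
    (hd : ∀ y, y ∉ S → HasDerivAt h (h' y) y) (hd' : ∀ y, y ∉ S → HasDerivAt h' (h'' y) y)
    (hi : ∀ a b, IntervalIntegrable h'' MeasureTheory.volume a b)
    (hq : ∀ a b, IntervalIntegrable q MeasureTheory.volume a b)
    (hq0 : ∀ y, 0 ≤ q y) (hqh : ∀ y, -q y ≤ h'' y) (c : ℝ) (K : ℕ)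
    (h0 : h c = 0) (h1 : h (c + K) = 0) (h0' : h' c = 0) (h1' : h' (c + K) = 0) :
    |∑ k ∈ range K, h (c + k) - ∫ y in c..c + K, h y| ≤ 1 / 8 * ∫ y in c..c + K, q y := by
  have hb : ∀ k : ℕ, _ := fun k => trapezoid_bounds hS hc hc' hd hd' hi hq hq0 hqh (c + k)
  have hsum : ∀ f : ℝ → ℝ, (∀ a b, IntervalIntegrable f MeasureTheory.volume a b) →
      ∑ k ∈ range K, ∫ y in c + k..c + k + 1, f y = ∫ y in c..c + K, f y := by
    intro f hf
    have := intervalIntegral.sum_integral_adjacent_intervals (f := f)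
      (μ := MeasureTheory.volume) (a := fun k : ℕ => c + k) (n := K) fun k _ => hf _ _
    simpa [add_assoc] using this
  have htrap : ∑ k ∈ range K, (h (c + k) + h (c + k + 1)) / 2 = ∑ k ∈ range K, h (c + k) := by
    have := sum_range_sub (fun k : ℕ => h (c + k)) K
    simp only [Nat.cast_add, Nat.cast_one, Nat.cast_zero, add_zero, h0, h1, sub_zero,
      sum_sub_distrib, ← add_assoc, sub_eq_zero] at this
    rw [← sum_div, sum_add_distrib, this]
    ring
  have hder : ∑ k ∈ range K, (h' (c + k + 1) - h' (c + k)) = 0 := by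
    have := sum_range_sub (fun k : ℕ => h' (c + k)) K
    simpa [h0', h1', add_assoc] using this
  have lo := sum_le_sum fun k (_ : k ∈ range K) => (hb k).1
  have up := sum_le_sum fun k (_ : k ∈ range K) => (hb k).2
  rw [sum_sub_distrib, ← mul_sum, htrap, hsum h fun a b => hc.intervalIntegrable a b,
    hsum q hq] at lo
  rw [sum_sub_distrib, sum_add_distrib, ← mul_sum, ← mul_sum, hder, htrap,
    hsum h fun a b => hc.intervalIntegrable a b, hsum q hq] at up
  rw [abs_le]
  constructor <;> linarith

/-- With `r = R + 2`, `s = T + 2` and `z = x - y`, the right side is the second derivative of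
`y ^ r (x - y) ^ s / (r! s!)` in `y`.  It is the integrand times the square
`(r / y - s / (x - y)) ^ 2`, minus two terms that are smaller than its own outer terms by the
factors `r - 1` and `s - 1`. -/
theorem truncPow_mul_second_deriv_lower (R T : ℕ) (y z : ℝ) :
    -(1 / ((R : ℝ) + 1) * (truncPow R y * truncPow (T + 2) z) +
        1 / ((T : ℝ) + 1) * (truncPow (R + 2) y * truncPow T z)) ≤
      truncPow R y * truncPow (T + 2) z - 2 * (truncPow (R + 1) y * truncPow (T + 1) z) +
        truncPow (R + 2) y * truncPow T z := by
  rcases lt_or_ge y 0 with hy | hy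
  · simp [truncPow_of_neg _ hy]
  rcases lt_or_ge z 0 with hz | hz
  · simp [truncPow_of_neg _ hz]
  have e2 : ∀ (r : ℕ) (t : ℝ), 0 ≤ t → truncPow (r + 2) t =
      truncPow r t * (t ^ 2 / (((r : ℝ) + 1) * ((r : ℝ) + 2))) := by
    intro r t ht
    have : (r.factorial : ℝ) ≠ 0 := by positivity
    rw [truncPow_of_nonneg _ ht, truncPow_of_nonneg _ ht, Nat.factorial_succ, Nat.factorial_succ]
    push_cast
    field_simp
    ring
  have e1 : ∀ (r : ℕ) (t : ℝ), 0 ≤ t → truncPow (r + 1) t = truncPow r t * (t / ((r : ℝ) + 1)) := by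
    intro r t ht
    have : (r.factorial : ℝ) ≠ 0 := by positivity
    rw [truncPow_of_nonneg _ ht, truncPow_of_nonneg _ ht, Nat.factorial_succ]
    push_cast
    field_simp
    ring
  rw [e2 R y hy, e2 T z hz, e1 R y hy, e1 T z hz]
  have h := mul_nonneg (mul_nonneg (truncPow_nonneg R y) (truncPow_nonneg T z))
    (div_nonneg (sq_nonneg (((R : ℝ) + 2) * z - ((T : ℝ) + 2) * y))
      (by positivity : (0 : ℝ) ≤ ((R : ℝ) + 1) * (R + 2) * (T + 1) * (T + 2)))
  refine sub_nonneg.1 (h.trans_eq ?_)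
  field_simp
  ring

/-- The sum of `y ^ r (x - y) ^ s / (r! s!)` over a lattice is close to its integral. -/
theorem abs_sum_truncPow_mul_sub_le {δ : ℝ} (hδ : 0 < δ) {r s : ℕ} (hr : 2 ≤ r) (hs : 2 ≤ s)
    (hrδ : δ ≤ (r : ℝ) - 1) (hsδ : δ ≤ (s : ℝ) - 1) {ξ x : ℝ} (hξ : 0 ≤ ξ) {K : ℕ} (hK : x ≤ K) :
    |∑ k ∈ range K, truncPow r ((k : ℝ) - ξ) * truncPow s (x - k) - truncPow (r + s + 1) (x - ξ)| ≤
      1 / (3 * δ) * truncPow (r + s - 1) (x - ξ) := by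
  obtain ⟨R, rfl⟩ := Nat.exists_eq_add_of_le' hr
  obtain ⟨T, rfl⟩ := Nat.exists_eq_add_of_le' hs
  set X := x - ξ with hX
  have c1 := fun r => continuous_truncPow (r := r + 1) (by omega)
  have hii := fun r s a b => intervalIntegrable_truncPow_mul r s X a b
  have main := abs_sum_sub_integral_le (S := {0, X})
    (h := fun y => truncPow (R + 2) y * truncPow (T + 2) (X - y))
    (h' := fun y => truncPow (R + 1) y * truncPow (T + 2) (X - y) -
      truncPow (R + 2) y * truncPow (T + 1) (X - y))
    (h'' := fun y => truncPow R y * truncPow (T + 2) (X - y) -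
      2 * (truncPow (R + 1) y * truncPow (T + 1) (X - y)) + truncPow (R + 2) y * truncPow T (X - y))
    (q := fun y => 1 / ((R : ℝ) + 1) * (truncPow R y * truncPow (T + 2) (X - y)) +
        1 / ((T : ℝ) + 1) * (truncPow (R + 2) y * truncPow T (X - y)))
    (Set.toFinite _).countable
    ((c1 _).mul ((c1 _).comp (by fun_prop)))
    (((c1 _).mul ((c1 _).comp (by fun_prop))).sub ((c1 _).mul ((c1 _).comp (by fun_prop))))
    (fun y hy => by
      simp only [Set.mem_insert_iff, Set.mem_singleton_iff, not_or] at hy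
      exact ((hasDerivAt_truncPow (R + 1) hy.1).mul
        (hasDerivAt_truncPow_sub (T + 1) hy.2)).congr_deriv (by ring))
    (fun y hy => by
      simp only [Set.mem_insert_iff, Set.mem_singleton_iff, not_or] at hy
      exact (((hasDerivAt_truncPow R hy.1).mul (hasDerivAt_truncPow_sub (T + 1) hy.2)).sub
        ((hasDerivAt_truncPow (R + 1) hy.1).mul
          (hasDerivAt_truncPow_sub T hy.2))).congr_deriv (by ring))
    (fun a b => (((hii _ _ a b).sub ((hii _ _ a b).const_mul 2)).add (hii _ _ a b)))
    (fun a b => ((hii _ _ a b).const_mul _).add ((hii _ _ a b).const_mul _))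
    (fun y => by
      have h := fun r s => mul_nonneg (truncPow_nonneg r y) (truncPow_nonneg s (X - y))
      have h1 := h R (T + 2)
      have h2 := h (R + 2) T
      positivity)
    (fun y => truncPow_mul_second_deriv_lower R T y (X - y)) (-ξ) K
    (by simp [truncPow_of_nonpos (r := R + 2) (by omega) (neg_nonpos.2 hξ)])
    (by
      rw [truncPow_of_nonpos (r := T + 2) (y := X - _) (by omega) (by rw [hX]; linarith),
        mul_zero])
    (by
      simp [truncPow_of_nonpos (r := R + 2) (by omega) (neg_nonpos.2 hξ),
        truncPow_of_nonpos (r := R + 1) (by omega) (neg_nonpos.2 hξ)])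
    (by
      rw [truncPow_of_nonpos (r := T + 2) (y := X - _) (by omega) (by rw [hX]; linarith),
        truncPow_of_nonpos (r := T + 1) (y := X - _) (by omega) (by rw [hX]; linarith)]
      simp)
  have hXK : X ≤ -ξ + K := by rw [hX]; linarith
  rw [intervalIntegral.integral_add ((hii _ _ _ _).const_mul _) ((hii _ _ _ _).const_mul _),
    intervalIntegral.integral_const_mul, intervalIntegral.integral_const_mul,
    integral_truncPow_mul _ _ (neg_nonpos.2 hξ) hXK,
    integral_truncPow_mul _ _ (neg_nonpos.2 hξ) hXK,
    integral_truncPow_mul _ _ (neg_nonpos.2 hξ) hXK] at main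
  have hsum : ∑ k ∈ range K, truncPow (R + 2) ((k : ℝ) - ξ) * truncPow (T + 2) (x - k) =
      ∑ k ∈ range K, truncPow (R + 2) (-ξ + k) * truncPow (T + 2) (X - (-ξ + k)) := by
    refine sum_congr rfl fun k _ => ?_
    rw [hX, show -ξ + (k : ℝ) = k - ξ by ring, show x - ξ - (k - ξ) = x - k by ring]
  rw [hsum]
  refine main.trans ?_
  rw [show R + (T + 2) + 1 = R + 2 + (T + 2) - 1 by omega,
    show R + 2 + T + 1 = R + 2 + (T + 2) - 1 by omega, ← add_mul, ← mul_assoc]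
  refine mul_le_mul_of_nonneg_right ?_ (truncPow_nonneg _ _)
  push_cast at hrδ hsδ
  have h1 : 1 / ((R : ℝ) + 1) ≤ 1 / δ := one_div_le_one_div_of_le hδ (by linarith)
  have h2 : 1 / ((T : ℝ) + 1) ≤ 1 / δ := one_div_le_one_div_of_le hδ (by linarith)
  have h3 : 1 / (3 * δ) = 1 / 3 * (1 / δ) := by field_simp
  have h4 : 0 < 1 / δ := by positivity
  rw [h3]
  linarith

/-! ### Unit averages -/

/-- The average of `u` over the unit interval that ends at `x`. -/
noncomputable def unitAvg (u : ℝ → ℝ) (x : ℝ) : ℝ := ∫ s in (0 : ℝ)..1, u (x - s)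

theorem continuous_unitAvg {u : ℝ → ℝ} (hu : Continuous u) : Continuous (unitAvg u) :=
  intervalIntegral.continuous_parametric_intervalIntegral_of_continuous'
    (f := fun x s => u (x - s)) (by fun_prop) 0 1

theorem continuous_unitAvg_iterate {u : ℝ → ℝ} (hu : Continuous u) (j : ℕ) :
    Continuous (unitAvg^[j] u) := by
  induction j with
  | zero => exact hu
  | succ j ih =>
    rw [Function.iterate_succ_apply']
    exact continuous_unitAvg ih

theorem unitAvg_mono_on {u v : ℝ → ℝ} (hu : Continuous u) (hv : Continuous v) {c : ℝ}
    (h : ∀ x, c ≤ x → u x ≤ v x) {x : ℝ} (hx : c + 1 ≤ x) : unitAvg u x ≤ unitAvg v x := by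
  refine intervalIntegral.integral_mono_on zero_le_one
    (Continuous.intervalIntegrable (by fun_prop) _ _)
    (Continuous.intervalIntegrable (by fun_prop) _ _) fun s hs => h _ ?_
  linarith [hs.2]

theorem unitAvg_iterate_mono_on {u v : ℝ → ℝ} (hu : Continuous u) (hv : Continuous v) {c : ℝ}
    (h : ∀ x, c ≤ x → u x ≤ v x) (j : ℕ) {x : ℝ} (hx : c + j ≤ x) :
    unitAvg^[j] u x ≤ unitAvg^[j] v x := by
  induction j generalizing x with
  | zero => exact h x (by simpa using hx)
  | succ j ih =>
    rw [Function.iterate_succ_apply', Function.iterate_succ_apply']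
    refine unitAvg_mono_on (continuous_unitAvg_iterate hu j) (continuous_unitAvg_iterate hv j)
      (c := c + j) (fun x hx => ih hx) ?_
    push_cast at hx
    linarith

theorem unitAvg_iterate_const_mul (C : ℝ) (u : ℝ → ℝ) (j : ℕ) (x : ℝ) :
    unitAvg^[j] (fun y => C * u y) x = C * unitAvg^[j] u x := by
  induction j generalizing x with
  | zero => rfl
  | succ j ih =>
    rw [Function.iterate_succ_apply', Function.iterate_succ_apply', unitAvg, unitAvg,
      ← intervalIntegral.integral_const_mul]
    simp only [ih]

theorem unitAvg_iterate_const (C : ℝ) (j : ℕ) (x : ℝ) : unitAvg^[j] (fun _ => C) x = C := by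
  induction j generalizing x with
  | zero => rfl
  | succ j ih =>
    rw [Function.iterate_succ_apply', unitAvg]
    simp [ih]

/-- The average over the unit interval of a truncated power is a difference of truncated powers. -/
theorem unitAvg_truncPow (r : ℕ) (x : ℝ) :
    unitAvg (truncPow r) x = truncPow (r + 1) x - truncPow (r + 1) (x - 1) := by
  rw [unitAvg, intervalIntegral.integral_comp_sub_left (fun y => truncPow r y),
    MeasureTheory.integral_eq_of_hasDerivAt_off_countable (truncPow (r + 1)) (truncPow r)
      (s := {0}) (Set.countable_singleton 0)
      (continuous_truncPow (by omega)).continuousOn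
      (fun y hy => hasDerivAt_truncPow r hy.2)
      (truncPow_mono r).intervalIntegrable, sub_zero]

/-- Iterated averages of truncated powers are iterated differences. -/
theorem unitAvg_iterate_truncPow (j N : ℕ) (x : ℝ) :
    unitAvg^[j] (truncPow N) x =
      ∑ i ∈ range (j + 1), (-1 : ℝ) ^ i * (j.choose i : ℝ) * truncPow (N + j) (x - i) := by
  induction j generalizing N x with
  | zero => simp
  | succ j ih =>
    have hii : ∀ i ∈ range (j + 1), IntervalIntegrable
        (fun s => (-1 : ℝ) ^ i * (j.choose i : ℝ) * truncPow (N + j) (x - s - i))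
        MeasureTheory.volume 0 1 := by
      intro i _
      refine IntervalIntegrable.const_mul (Antitone.intervalIntegrable fun s t hst => ?_) _
      exact truncPow_mono _ (by linarith)
    have h1 : ∀ i : ℕ, ∫ s in (0 : ℝ)..1, truncPow (N + j) (x - s - i) =
        truncPow (N + j + 1) (x - i) - truncPow (N + j + 1) (x - (i + 1 : ℕ)) := by
      intro i
      have := unitAvg_truncPow (N + j) (x - i)
      rw [unitAvg] at this
      push_cast
      rw [← sub_sub, ← this]
      simp only [sub_right_comm]
    rw [Function.iterate_succ_apply', unitAvg]
    simp only [ih]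
    rw [intervalIntegral.integral_finsetSum hii]
    simp only [intervalIntegral.integral_const_mul, h1, mul_sub]
    rw [sum_sub_distrib, ← add_assoc]
    set F : ℕ → ℝ := fun i => truncPow (N + j + 1) (x - i) with hF
    change ∑ i ∈ range (j + 1), (-1 : ℝ) ^ i * (j.choose i : ℝ) * F i -
      ∑ i ∈ range (j + 1), (-1 : ℝ) ^ i * (j.choose i : ℝ) * F (i + 1) =
      ∑ i ∈ range (j + 1 + 1), (-1 : ℝ) ^ i * ((j + 1).choose i : ℝ) * F i
    have h2 : ∑ i ∈ range (j + 1), (-1 : ℝ) ^ i * (j.choose i : ℝ) * F i =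
        ∑ i ∈ range (j + 1 + 1), (-1 : ℝ) ^ i * (j.choose i : ℝ) * F i := by
      rw [sum_range_succ _ (j + 1)]
      simp
    rw [h2, sum_range_succ' _ (j + 1), sum_range_succ' _ (j + 1), add_sub_right_comm,
      ← sum_sub_distrib]
    congr 1
    -- Pascal's rule
    · refine sum_congr rfl fun i _ => ?_
      rw [Nat.choose_succ_succ]
      push_cast
      ring
    · simp

theorem abs_integral_sub_le {u v w : ℝ → ℝ} (hu : Continuous u) (hv : Continuous v)
    (hw : Continuous w) (h : ∀ s ∈ Set.Icc (0 : ℝ) 1, |u s - v s| ≤ w s) :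
    |(∫ s in (0 : ℝ)..1, u s) - ∫ s in (0 : ℝ)..1, v s| ≤ ∫ s in (0 : ℝ)..1, w s := by
  rw [← intervalIntegral.integral_sub (hu.intervalIntegrable _ _) (hv.intervalIntegrable _ _)]
  refine (intervalIntegral.abs_integral_le_integral_abs zero_le_one).trans ?_
  exact intervalIntegral.integral_mono_on zero_le_one
    ((hu.sub hv).abs.intervalIntegrable _ _) (hw.intervalIntegrable _ _) h

/-- The comparison of lattice sum and integral survives averaging in the second factor. -/
theorem abs_sum_truncPow_mul_unitAvg_sub_le {δ : ℝ} (hδ : 0 < δ) {r s : ℕ} (hr : 2 ≤ r)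
    (hs : 2 ≤ s) (hrδ : δ ≤ (r : ℝ) - 1) (hsδ : δ ≤ (s : ℝ) - 1) (j : ℕ) {ξ x : ℝ} (hξ : 0 ≤ ξ)
    {K : ℕ} (hK : x ≤ K) :
    |∑ k ∈ range K, truncPow r ((k : ℝ) - ξ) * unitAvg^[j] (truncPow s) (x - k) -
        unitAvg^[j] (truncPow (r + s + 1)) (x - ξ)| ≤
      1 / (3 * δ) * unitAvg^[j] (truncPow (r + s - 1)) (x - ξ) := by
  induction j generalizing x with
  | zero => exact abs_sum_truncPow_mul_sub_le hδ hr hs hrδ hsδ hξ hK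
  | succ j ih =>
    have c1 := continuous_unitAvg_iterate (continuous_truncPow (r := s) (by omega)) j
    have c2 := continuous_unitAvg_iterate (continuous_truncPow (r := r + s + 1) (by omega)) j
    have c3 := continuous_unitAvg_iterate (continuous_truncPow (r := r + s - 1) (by omega)) j
    simp only [Function.iterate_succ_apply', unitAvg]
    simp only [← intervalIntegral.integral_const_mul]
    rw [← intervalIntegral.integral_finsetSum fun k _ =>
      Continuous.intervalIntegrable (by fun_prop) _ _]
    refine abs_integral_sub_le (by fun_prop) (by fun_prop) (by fun_prop) fun t ht => ?_
    have h := ih (x := x - t) (by linarith [ht.1])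
    simpa only [sub_right_comm] using h

/-- One convolution step: a lattice sum against the difference `k ^ D - (k - 1) ^ D`, which is the
average of `D (k - ξ) ^ (D - 1)` over `ξ`, is close to one more averaged convolution. -/
theorem abs_sum_diff_mul_unitAvg_sub_le {δ : ℝ} (hδ : 0 < δ) {D s : ℕ} (hD : 3 ≤ D)
    (hs : 2 ≤ s) (hDδ : δ ≤ (D : ℝ) - 2) (hsδ : δ ≤ (s : ℝ) - 1) (j : ℕ) {x : ℝ}
    {K : ℕ} (hK : x ≤ K) :
    |∑ k ∈ range K, (truncPow D k - truncPow D (k - 1)) * unitAvg^[j] (truncPow s) (x - k) -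
        unitAvg^[j + 1] (truncPow (s + D)) x| ≤
      1 / (3 * δ) * unitAvg^[j + 1] (truncPow (s + D - 2)) x := by
  obtain ⟨r, rfl⟩ : ∃ r, D = r + 1 := ⟨D - 1, by omega⟩
  push_cast at hDδ
  have c1 := continuous_truncPow (r := r) (by omega)
  have c2 := continuous_unitAvg_iterate (continuous_truncPow (r := s + (r + 1)) (by omega)) j
  have c3 := continuous_unitAvg_iterate (continuous_truncPow (r := s + (r + 1) - 2) (by omega)) j
  simp only [← unitAvg_truncPow]
  simp only [Function.iterate_succ_apply', unitAvg]
  simp only [← intervalIntegral.integral_const_mul, ← intervalIntegral.integral_mul_const]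
  rw [← intervalIntegral.integral_finsetSum fun k _ =>
    Continuous.intervalIntegrable (by fun_prop) _ _]
  refine abs_integral_sub_le (by fun_prop) (by fun_prop) (by fun_prop) fun t ht => ?_
  have h := abs_sum_truncPow_mul_unitAvg_sub_le hδ (r := r) (s := s) (by omega) hs (by linarith)
    hsδ j ht.1 hK
  rwa [show r + s + 1 = s + (r + 1) by omega, show r + s - 1 = s + (r + 1) - 2 by omega] at h

/-! ### The number of words as an integral -/

/-- Formally `(1 + α (d/dx)²) ^ j` applied to the `l`-fold average of the truncated power `N`. -/
noncomputable def errorBound (α : ℝ) (l : ℕ) : ℕ → ℕ → ℝ → ℝ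
  | 0, N, x => unitAvg^[l] (truncPow N) x
  | j + 1, N, x => errorBound α l j N x + α * errorBound α l j (N - 2) x

/-- One convolution step carries the bound for `j` lattice sums to the bound for `j + 1`. -/
theorem sum_diff_mul_errorBound_le {δ : ℝ} (hδ : 0 < δ) {D : ℕ} (hD : 3 ≤ D)
    (hDδ : δ ≤ (D : ℝ) - 2) (l j : ℕ) {N : ℕ} (hN : 2 * j + 2 ≤ N)
    (hNδ : δ ≤ (N : ℝ) - 2 * j - 1) {x : ℝ} {K : ℕ} (hK : x ≤ K) :
    ∑ k ∈ range K, (truncPow D k - truncPow D (k - 1)) *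
        errorBound (1 / (3 * δ)) l j N (x - k) ≤
      errorBound (1 / (3 * δ)) (l + 1) (j + 1) (N + D) x := by
  induction j generalizing N with
  | zero =>
    have h := abs_sum_diff_mul_unitAvg_sub_le hδ hD (s := N) (by omega) hDδ
      (by simpa using hNδ) l hK
    simp only [errorBound]
    linarith [(abs_le.1 h).2]
  | succ j ih =>
    push_cast at hNδ
    have h1 := ih (N := N) (by omega) (by linarith)
    have h2 := ih (N := N - 2) (by omega) (by
      rw [Nat.cast_sub (by omega)]; push_cast; linarith)
    have hα : (0 : ℝ) ≤ 1 / (3 * δ) := by positivity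
    rw [show N - 2 + D = N + D - 2 by omega] at h2
    have h3 := mul_le_mul_of_nonneg_left h2 hα
    have h4 := add_le_add h1 h3
    rw [mul_sum, ← sum_add_distrib] at h4
    rw [errorBound]
    refine le_trans (le_of_eq (sum_congr rfl fun k _ => ?_)) h4
    rw [errorBound]
    ring

/-- The same step for the excess of the bound over its main term; what is left over on the right
pays for replacing the lattice sum of the main term by its integral. -/
theorem sum_diff_mul_errorBound_sub_le {δ : ℝ} (hδ : 0 < δ) {D : ℕ} (hD : 3 ≤ D)
    (hDδ : δ ≤ (D : ℝ) - 2) (l j : ℕ) {N : ℕ} (hN : 2 * j + 2 ≤ N)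
    (hNδ : δ ≤ (N : ℝ) - 2 * j - 1) {x : ℝ} {K : ℕ} (hK : x ≤ K) :
    ∑ k ∈ range K, (truncPow D k - truncPow D (k - 1)) *
        (errorBound (1 / (3 * δ)) l j N (x - k) - unitAvg^[l] (truncPow N) (x - k)) ≤
      errorBound (1 / (3 * δ)) (l + 1) (j + 1) (N + D) x -
        unitAvg^[l + 1] (truncPow (N + D)) x -
        1 / (3 * δ) * unitAvg^[l + 1] (truncPow (N + D - 2)) x := by
  induction j with
  | zero => simp [errorBound]
  | succ j ih =>
    push_cast at hNδ
    have h1 := ih (by omega) (by linarith)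
    have h2 := sum_diff_mul_errorBound_le hδ hD hDδ l j (N := N - 2) (by omega) (by
      rw [Nat.cast_sub (by omega)]; push_cast; linarith) hK
    have hα : (0 : ℝ) ≤ 1 / (3 * δ) := by positivity
    rw [show N - 2 + D = N + D - 2 by omega] at h2
    have h3 := mul_le_mul_of_nonneg_left h2 hα
    have h4 := add_le_add h1 h3
    rw [mul_sum, ← sum_add_distrib] at h4
    rw [errorBound]
    refine le_trans (le_of_eq (sum_congr rfl fun k _ => ?_)) (h4.trans_eq (by ring))
    rw [errorBound]
    ring

/-- Normalized by the factorials, the recursion for `strictCount` is a lattice convolution with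
differences of truncated powers.  The index is the largest letter of the first type, and the term
for the letter `0` vanishes. -/
theorem strictCount_succ_div (j : ℕ) (D : Fin (j + 2) → ℕ) (hD : D 0 ≠ 0) (b : ℕ) :
    strictCount (j + 1) D b / ∏ i, ((D i).factorial : ℝ) =
      ∑ k ∈ range (b + 1), (truncPow (D 0) k - truncPow (D 0) (k - 1)) *
        (strictCount j (Fin.tail D) (b - k) / ∏ i, ((Fin.tail D i).factorial : ℝ)) := by
  rw [sum_range_succ', strictCount, Fin.prod_univ_succ, sum_div]
  have h0 : truncPow (D 0) ((0 : ℕ) : ℝ) - truncPow (D 0) (((0 : ℕ) : ℝ) - 1) = 0 := by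
    rw [truncPow_of_nonpos hD (by simp), truncPow_of_nonpos hD (by simp), sub_zero]
  rw [h0, zero_mul, add_zero]
  refine sum_congr rfl fun k _ => ?_
  rw [truncPow_of_nonneg _ (by positivity),
    truncPow_of_nonneg _ (by push_cast; linarith [k.cast_nonneg (α := ℝ)]), ← sub_div,
    div_mul_div_comm]
  push_cast
  rw [add_sub_cancel_right]
  rfl

/-- The number of words that reverse the deck is close to the volume that it counts the lattice
points of. -/
theorem abs_strictCount_sub_le {d : ℕ} (hd : 3 ≤ d) (j : ℕ) (D : Fin (j + 1) → ℕ)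
    (hD : ∀ i, d ≤ D i) (b : ℕ) :
    |strictCount j D b / ∏ i, ((D i).factorial : ℝ) - unitAvg^[j] (truncPow (∑ i, D i)) b| ≤
      errorBound (1 / (3 * ((d : ℝ) - 2))) j j (∑ i, D i) b -
        unitAvg^[j] (truncPow (∑ i, D i)) b := by
  induction j generalizing b with
  | zero => simp [strictCount, errorBound, truncPow_of_nonneg]
  | succ j ih =>
    set N := ∑ i, Fin.tail D i with hN
    have hsum : ∑ i, D i = N + D 0 := by rw [Fin.sum_univ_succ, add_comm]; rfl
    have hd' : (3 : ℝ) ≤ d := by exact_mod_cast hd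
    have hD0 : (d : ℝ) ≤ D 0 := by exact_mod_cast hD 0
    have hNd : d * (j + 1) ≤ N := by
      have := Finset.card_nsmul_le_sum univ (Fin.tail D) d fun i _ => hD i.succ
      simpa [mul_comm] using this
    have hNd' : d + 2 * j ≤ N := by nlinarith
    have hNd'' : (d : ℝ) + 2 * j ≤ N := by exact_mod_cast hNd'
    have hδ : (0 : ℝ) < (d : ℝ) - 2 := by linarith
    have hK : (b : ℝ) ≤ (b + 1 : ℕ) := by push_cast; linarith
    have h1 := sum_diff_mul_errorBound_sub_le hδ ((hd.trans (hD 0))) (by linarith) j j (N := N)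
      (by omega) (by linarith) hK
    have h2 := abs_sum_diff_mul_unitAvg_sub_le hδ ((hd.trans (hD 0))) (s := N) (by omega)
      (by linarith) (by linarith) j hK
    rw [hsum, strictCount_succ_div j D (by have := hD 0; omega)]
    set f : ℕ → ℝ := fun k => truncPow (D 0) k - truncPow (D 0) (k - 1) with hf
    have hf0 : ∀ k, 0 ≤ f k := fun k => sub_nonneg.2 (truncPow_mono _ (by linarith))
    have h3 : |∑ k ∈ range (b + 1), f k *
          (strictCount j (Fin.tail D) (b - k) / ∏ i, ((Fin.tail D i).factorial : ℝ)) -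
        ∑ k ∈ range (b + 1), f k * unitAvg^[j] (truncPow N) (b - k)| ≤
        ∑ k ∈ range (b + 1), f k * (errorBound (1 / (3 * ((d : ℝ) - 2))) j j N (b - k) -
          unitAvg^[j] (truncPow N) (b - k)) := by
      rw [← sum_sub_distrib]
      refine (abs_sum_le_sum_abs _ _).trans (sum_le_sum fun k hk => ?_)
      have hkb : k ≤ b := Nat.lt_succ_iff.1 (mem_range.1 hk)
      have := ih (Fin.tail D) (fun i => hD i.succ) (b - k)
      rw [Nat.cast_sub hkb] at this
      rw [← mul_sub, abs_mul, abs_of_nonneg (hf0 k)]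
      exact mul_le_mul_of_nonneg_left this (hf0 k)
    refine (abs_sub_le _ (∑ k ∈ range (b + 1), f k * unitAvg^[j] (truncPow N) (b - k)) _).trans ?_
    linarith

/-- On arguments `z ≥ c`, two derivatives of `z ^ N` cost at most a factor `n ^ 2 / c ^ 2`. -/
theorem errorBound_le {α β c : ℝ} (hα : 0 ≤ α) (hc : 0 ≤ c) {n : ℕ}
    (hβ : α * (n : ℝ) ^ 2 ≤ β * c ^ 2) (hβ0 : 0 ≤ β) (l j : ℕ) {N : ℕ} (hN : 2 * j < N)
    (hNn : N ≤ n) {x : ℝ} (hx : c + l ≤ x) :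
    errorBound α l j N x ≤ (1 + β) ^ j * unitAvg^[l] (truncPow N) x := by
  induction j generalizing N with
  | zero => simp [errorBound]
  | succ j ih =>
    have h1 := ih (N := N) (by omega) hNn
    have h2 := ih (N := N - 2) (by omega) (by omega)
    have h3 : α * unitAvg^[l] (truncPow (N - 2)) x ≤ β * unitAvg^[l] (truncPow N) x := by
      rw [← unitAvg_iterate_const_mul, ← unitAvg_iterate_const_mul]
      have c1 := continuous_truncPow (r := N) (by omega)
      have c2 := continuous_truncPow (r := N - 2) (by omega)
      refine unitAvg_iterate_mono_on (by fun_prop) (by fun_prop) (c := c) (fun z hz => ?_) l hx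
      obtain ⟨M, rfl⟩ : ∃ M, N = M + 2 := ⟨N - 2, by omega⟩
      have hz0 : 0 ≤ z := hc.trans hz
      rw [Nat.add_sub_cancel, truncPow_of_nonneg _ hz0, truncPow_of_nonneg _ hz0,
        Nat.factorial_succ, Nat.factorial_succ]
      have hfac : (0 : ℝ) < M.factorial := by positivity
      have hMn : ((M : ℝ) + 1 + 1) ≤ n := by exact_mod_cast hNn
      have h4 : α * (((M : ℝ) + 1 + 1) * ((M : ℝ) + 1)) ≤ β * z ^ 2 := by
        refine le_trans ?_ (hβ.trans ?_)
        · refine mul_le_mul_of_nonneg_left ?_ hα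
          nlinarith
        · gcongr
      have h5 : β * (z ^ (M + 2) / (((M + 1 + 1) * ((M + 1) * M.factorial) : ℕ) : ℝ)) -
          α * (z ^ M / (M.factorial : ℝ)) =
          z ^ M / (M.factorial : ℝ) / (((M : ℝ) + 1 + 1) * ((M : ℝ) + 1)) *
            (β * z ^ 2 - α * (((M : ℝ) + 1 + 1) * ((M : ℝ) + 1))) := by
        push_cast
        field_simp
        ring
      rw [← sub_nonneg, h5]
      exact mul_nonneg (by positivity) (sub_nonneg.2 h4)
    have hp : 0 ≤ (1 + β) ^ j := by positivity
    calc errorBound α l j N x + α * errorBound α l j (N - 2) x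
        ≤ (1 + β) ^ j * unitAvg^[l] (truncPow N) x +
          α * ((1 + β) ^ j * unitAvg^[l] (truncPow (N - 2)) x) := by gcongr
      _ = (1 + β) ^ j * (unitAvg^[l] (truncPow N) x + α * unitAvg^[l] (truncPow (N - 2)) x) := by
          ring
      _ ≤ (1 + β) ^ j * (unitAvg^[l] (truncPow N) x + β * unitAvg^[l] (truncPow N) x) := by gcongr
      _ = (1 + β) ^ (j + 1) * unitAvg^[l] (truncPow N) x := by ring

theorem unitAvg_iterate_truncPow_pos (l N : ℕ) (hN : N ≠ 0) {x : ℝ} (hx : 1 + (l : ℝ) ≤ x) :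
    0 < unitAvg^[l] (truncPow N) x := by
  have h := unitAvg_iterate_mono_on (u := fun _ => 1 / (N.factorial : ℝ)) continuous_const
    (continuous_truncPow hN) (c := 1) (fun z hz => ?_) l hx
  · rw [unitAvg_iterate_const] at h
    exact lt_of_lt_of_le (by positivity) h
  · rw [truncPow_of_nonneg _ (zero_le_one.trans hz)]
    gcongr
    exact one_le_pow₀ hz

/-- The main term as an iterated average. -/
theorem thumbTerm_eq (n j a : ℕ) (ha : j ≤ a) (ha0 : a ≠ 0) :
    thumbTerm n (j + 1) a = (n.factorial : ℝ) / (a : ℝ) ^ n * unitAvg^[j] (truncPow n) a := by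
  have hprod : ∏ i ∈ Icc 1 j, ((n : ℝ) + (i : ℝ)) = ((n + j).factorial : ℝ) / n.factorial := by
    rw [eq_div_iff (by positivity)]
    induction j with
    | zero => simp
    | succ j ih =>
      rw [prod_Icc_succ_top (by omega), mul_right_comm, ih (by omega), ← add_assoc,
        Nat.factorial_succ]
      push_cast
      ring
  have ha' : (a : ℝ) ≠ 0 := by exact_mod_cast ha0
  have h1 : (n.factorial : ℝ) ≠ 0 := by positivity
  have h2 : ((n + j).factorial : ℝ) ≠ 0 := by positivity
  rw [thumbTerm, unitAvg_iterate_truncPow, mul_sum, mul_sum]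
  refine sum_congr rfl fun i hi => ?_
  have hij : i ≤ j := Nat.lt_succ_iff.1 (mem_range.1 hi)
  have hia : (0 : ℝ) ≤ a - i := sub_nonneg.2 (by exact_mod_cast hij.trans ha)
  rw [truncPow_of_nonneg _ hia, Nat.add_sub_cancel, show n + (j + 1) - 1 = n + j by omega, hprod,
    one_sub_div ha', div_pow, pow_add (a : ℝ)]
  field_simp

/-! ### The separation distance -/

theorem separation_eq {n j : ℕ} {w : Fin n → Fin (j + 1)} {D : Fin (j + 1) → ℕ}
    (hw : IsSortedDeck D w) (hD : ∀ i, 0 < D i) (a : ℕ) :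
    separation (shuffle n a) w =
      1 - (n.factorial : ℝ) / (a : ℝ) ^ n *
        (strictCount j D a / ∏ i, ((D i).factorial : ℝ)) := by
  have h := card_configurations w
  simp only [hw.2] at h
  have h' : ((configurations w).card : ℝ) * ∏ i, ((D i).factorial : ℝ) = n.factorial := by
    exact_mod_cast h
  have hne : ∏ i, ((D i).factorial : ℝ) ≠ 0 := prod_ne_zero_iff.2 fun i _ => by positivity
  rw [separation_shuffle hw.1, card_strictWords w D hw.2 hD, ← h']
  field_simp

/-- With at least two letters too few the error bound exceeds `1`, so that it allows the main term
to be cancelled. -/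
theorem one_le_thumbError {n m d a : ℕ} (hd : 3 ≤ d) (hn : m * d ≤ n) (ha : a + 1 < m) :
    1 ≤ thumbError n m d a := by
  have hd' : (3 : ℝ) ≤ d := by exact_mod_cast hd
  have hn' : (m : ℝ) * d ≤ n := by exact_mod_cast hn
  have ha' : (a : ℝ) + 1 + 1 ≤ m := by exact_mod_cast ha
  have ha0 : (0 : ℝ) ≤ a := a.cast_nonneg
  set B : ℝ := 3 * ((d : ℝ) - 2) * ((a : ℝ) - m + 1) ^ 2 with hB
  have hBpos : 0 < B := by
    have : (a : ℝ) - m + 1 ≠ 0 := by linarith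
    have : (0 : ℝ) < (d : ℝ) - 2 := by linarith
    positivity
  have hBn : B ≤ (n : ℝ) ^ 2 := by
    have h1 : ((a : ℝ) - m + 1) ^ 2 ≤ (m : ℝ) ^ 2 := by
      apply sq_le_sq' <;> linarith
    have h2 : 3 * ((d : ℝ) - 2) ≤ (d : ℝ) ^ 2 := by nlinarith
    calc B ≤ (d : ℝ) ^ 2 * (m : ℝ) ^ 2 := by
          rw [hB]
          gcongr
      _ = ((m : ℝ) * d) ^ 2 := by ring
      _ ≤ (n : ℝ) ^ 2 := by gcongr
  have h1 : 1 ≤ (n : ℝ) ^ 2 / B := (one_le_div hBpos).2 hBn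
  have h2 : 1 + (n : ℝ) ^ 2 / B ≤ (1 + (n : ℝ) ^ 2 / B) ^ (m - 1) :=
    le_self_pow₀ (by linarith) (by omega)
  rw [thumbError]
  linarith

theorem exists_separation_shuffle_eq {n j d : ℕ} (hd : 3 ≤ d) {D : Fin (j + 1) → ℕ}
    (hD : ∀ i, d ≤ D i) {w : Fin n → Fin (j + 1)} (hw : IsSortedDeck D w) {a : ℕ} (ha : 1 ≤ a) :
    ∃ η : ℝ, separation (shuffle n a) w = 1 - (1 + η) * thumbTerm n (j + 1) a ∧
      (a + 1 ≠ j + 1 → |η| ≤ thumbError n (j + 1) d a) := by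
  have hDpos : ∀ i, 0 < D i := fun i => by have := hD i; omega
  have hsum : ∑ i, D i = n := by
    have := card_eq_sum_card_fiberwise (f := w) (s := univ) (t := univ) (by simp)
    simp only [card_univ, Fintype.card_fin] at this
    rw [this]
    exact sum_congr rfl fun i _ => (hw.2 i).symm
  have hn : (j + 1) * d ≤ n := by
    have := card_nsmul_le_sum univ D d fun i _ => hD i
    simpa [hsum] using this
  rw [separation_eq hw hDpos]
  rcases Nat.lt_or_ge j a with hja | hja
  · have hja' : (1 : ℝ) + j ≤ a := by exact_mod_cast (by omega : 1 + j ≤ a)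
    have hpos := unitAvg_iterate_truncPow_pos j n (by nlinarith) hja'
    set V := unitAvg^[j] (truncPow n) a with hV
    set s := strictCount j D a / ∏ i, ((D i).factorial : ℝ) with hs
    have hd' : (0 : ℝ) < (d : ℝ) - 2 := by
      have : (3 : ℝ) ≤ d := by exact_mod_cast hd
      linarith
    set β : ℝ := (n : ℝ) ^ 2 / (3 * ((d : ℝ) - 2) * ((a : ℝ) - (j + 1 : ℕ) + 1) ^ 2) with hβ
    have hc : (0 : ℝ) < (a : ℝ) - (j + 1 : ℕ) + 1 := by push_cast; linarith
    have h1 := abs_strictCount_sub_le hd j D hD a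
    rw [hsum] at h1
    have h2 := errorBound_le (α := 1 / (3 * ((d : ℝ) - 2))) (β := β)
      (c := (a : ℝ) - (j + 1 : ℕ) + 1) (n := n) (by positivity) hc.le
      (by rw [hβ]; field_simp; exact le_rfl) (by positivity) j j (N := n) (by nlinarith) le_rfl
      (x := a) (by push_cast; linarith)
    have h3 : |s - V| ≤ ((1 + β) ^ j - 1) * V := by linarith
    refine ⟨s / V - 1, ?_, fun _ => ?_⟩
    · rw [thumbTerm_eq n j a (by omega) (by omega), ← hV]
      field_simp
      ring
    · rw [show s / V - 1 = (s - V) / V by field_simp, abs_div, abs_of_pos hpos,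
        div_le_iff₀ hpos]
      exact h3
  · rw [strictCount_eq_zero j D hDpos hja]
    refine ⟨-1, by simp, fun hne => ?_⟩
    rw [abs_neg, abs_one]
    exact one_le_thumbError hd hn (by omega)

end RiffleShuffle

theorem mainTheorem1 (n m d : ℕ) (hm : 1 ≤ m) (hd : 3 ≤ d)
    (D : Fin m → ℕ) (hD : ∀ i, d ≤ D i)
    (w : Fin n → Fin m) (hw : RiffleShuffle.IsSortedDeck D w) :
    (∀ a : ℕ, 1 ≤ a → ∃ η : ℝ,
      RiffleShuffle.separation (RiffleShuffle.shuffle n a) w =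
        1 - (1 + η) * RiffleShuffle.thumbTerm n m a ∧
      (a + 1 ≠ m → |η| ≤ RiffleShuffle.thumbError n m d a)) ∧
    (∀ k : ℕ, ∃ η : ℝ,
      RiffleShuffle.separation
          (RiffleShuffle.convPow (RiffleShuffle.shuffle n 2) k) w =
        1 - (1 + η) * RiffleShuffle.thumbTerm n m (2 ^ k) ∧
      (2 ^ k + 1 ≠ m → |η| ≤ RiffleShuffle.thumbError n m d (2 ^ k))) := by
  obtain ⟨j, rfl⟩ : ∃ j, m = j + 1 := ⟨m - 1, by omega⟩
  refine ⟨fun a ha => RiffleShuffle.exists_separation_shuffle_eq hd hD hw ha, fun k => ?_⟩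
  rw [RiffleShuffle.convPow_shuffle]
  simpa only [Nat.cast_pow] using
    RiffleShuffle.exists_separation_shuffle_eq hd hD hw (Nat.one_le_two_pow (n := k))
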